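/- Consider the real linear time-invariant plant $$\dot x = Ax + B_2u + B_1w,\qquad z = C_1x + D_{12}u,\qquad y = C_2x + D_{21}w,$$ with $x\in\mathbb R^n$, $w,z\in\mathbb R^m$, $u\in\mathbb R^q$, $y\in\mathbb R^p$, and suppose that $E_1=D_{12}^TD_{12}>0$ and $E_2=D_{21}D_{21}^T>0$. Terminology (eigenvalues are counted with algebraic multiplicity). A real $N\times N$ matrix is Hurwitz if all its eigenvalues have negative real part, and pseudo-Hurwitz if it has $N-1$ eigenvalues with negative real part and one eigenvalue with positive real part. A real symmetric $N\times N$ matrix is pseudo-positive definite if it has $N-1$ positive eigenvalues and one negative eigenvalue. A system $\dot\eta=\bar A\eta+\bar Bw$, $z=\bar C\eta$ with transfer function $G(s)=\bar C(sI-\bar A)^{-1}\bar B$ is pseudo strict bounded real if $\bar A$ is pseudo-Hurwitz and $\max_{\omega\in\mathbb R}\sigma_{\max}[G(-j\omega)^TG(j\omega)]<1$, where $\sigma_{\max}$ denotes the largest singular value. Finally, $\rho$ denotes the spectral radius. Suppose that: (i) the Riccati equation $$(A-B_2E_1^{-1}D_{12}^TC_1)^TX+X(A-B_2E_1^{-1}D_{12}^TC_1)+X(B_1B_1^T-B_2E_1^{-1}B_2^T)X+C_1^T(I-D_{12}E_1^{-1}D_{12}^T)C_1=0$$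 has a positive definite solution $X=X^T$ that is stabilizing, i.e. $A-B_2E_1^{-1}D_{12}^TC_1+(B_1B_1^T-B_2E_1^{-1}B_2^T)X$ is Hurwitz; (ii) the Riccati equation $$(A-B_1D_{21}^TE_2^{-1}C_2)Y+Y(A-B_1D_{21}^TE_2^{-1}C_2)^T+Y(C_1^TC_1-C_2^TE_2^{-1}C_2)Y+B_1(I-D_{21}^TE_2^{-1}D_{21})B_1^T=0$$ has a pseudo-positive definite solution $Y=Y^T$ that is stabilizing, i.e. $A-B_1D_{21}^TE_2^{-1}C_2+Y(C_1^TC_1-C_2^TE_2^{-1}C_2)$ is Hurwitz; (iii) $\rho(XY)<1$. Then there exists a dynamic output feedback compensator $\dot x_c=A_cx_c+B_cy$, $u=C_cx_c$ such that the closed-loop system from $w$ to $z$, with state $(x,x_c)$, $$\bar A=\begin{bmatrix}A&B_2C_c\\B_cC_2&A_c\end{bmatrix},\qquad \bar B=\begin{bmatrix}B_1\\B_cD_{21}\end{bmatrix},\qquad \bar C=\begin{bmatrix}C_1&D_{12}C_c\end{bmatrix},$$ is pseudo strict bounded real. Furthermore, $I-YX$ is invertible, and such a compensator (of order $n$) is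 given by $$\begin{aligned}A_c&=A+B_cC_2-B_2C_c+YC_1^T(C_1-D_{12}C_c),\\ B_c&=-(YC_2^T+B_1D_{21}^T)E_2^{-1},\\ C_c&=E_1^{-1}(B_2^TX+D_{12}^TC_1)(I-YX)^{-1}.\end{aligned}$$ -/

import Mathlib

open Matrix

noncomputable section

namespace PseudoHinf

/-- Entrywise inclusion of real matrices into complex matrices. -/
def toC {ι κ : Type*} (M : Matrix ι κ ℝ) : Matrix ι κ ℂ := M.map Complex.ofReal

/-- The eigenvalues of a real square matrix: complex numbers, counted with algebraic
multiplicity. -/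
def eigs {ι : Type*} [Fintype ι] [DecidableEq ι] (A : Matrix ι ι ℝ) : Multiset ℂ :=
  (toC A).charpoly.roots

/-- All eigenvalues have negative real part. -/
def IsHurwitz {ι : Type*} [Fintype ι] [DecidableEq ι] (A : Matrix ι ι ℝ) : Prop :=
  ∀ z ∈ eigs A, z.re < 0

open Classical in
/-- An `N × N` matrix is pseudo-Hurwitz if, with multiplicity, exactly `N - 1` eigenvalues have
negative real part and exactly one has positive real part. -/
def IsPseudoHurwitz {ι : Type*} [Fintype ι] [DecidableEq ι] (A : Matrix ι ι ℝ) : Prop :=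
  (eigs A).countP (fun z => z.re < 0) + 1 = Fintype.card ι ∧
    (eigs A).countP (fun z => 0 < z.re) = 1

/-- A real symmetric `N × N` matrix is pseudo-positive definite if, with multiplicity, exactly
`N - 1` eigenvalues are positive and exactly one is negative. (For real matrices `IsHermitian`
means symmetric, and `IsHermitian.eigenvalues` lists the eigenvalues with multiplicity.) -/
def IsPseudoPosDef {ι : Type*} [Fintype ι] [DecidableEq ι] (P : Matrix ι ι ℝ) : Prop :=
  ∃ h : P.IsHermitian,
    (Finset.univ.filter fun i => 0 < h.eigenvalues i).card + 1 = Fintype.card ι ∧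
      (Finset.univ.filter fun i => h.eigenvalues i < 0).card = 1

/-- The largest singular value of a complex matrix. -/
def sigmaMax {ι κ : Type*} [Fintype ι] [Fintype κ] [DecidableEq κ] (M : Matrix ι κ ℂ) : ℝ :=
  (Matrix.toEuclideanLin M).singularValues 0

/-- The linear time-invariant system `x' = A x + B w`, `z = C x`. -/
structure LTISystem (ι μ ν : Type*) where
  A : Matrix ι ι ℝ
  B : Matrix ι μ ℝ
  C : Matrix ν ι ℝ

/-- The transfer function `G(s) = C (sI - A)⁻¹ B`. -/
def LTISystem.transfer {ι μ ν : Type*} [Fintype ι] [DecidableEq ι]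
    (S : LTISystem ι μ ν) (s : ℂ) : Matrix ν μ ℂ :=
  toC S.C * (s • (1 : Matrix ι ι ℂ) - toC S.A)⁻¹ * toC S.B

/-- Pseudo strict bounded real: `A` is pseudo-Hurwitz, and the maximum over real `ω` of
`σ_max[G(-jω)ᵀ G(jω)]` exists and is less than one. -/
def LTISystem.IsPseudoStrictBoundedReal {ι μ ν : Type*} [Fintype ι] [DecidableEq ι]
    [Fintype μ] [DecidableEq μ] [Fintype ν] (S : LTISystem ι μ ν) : Prop :=
  IsPseudoHurwitz S.A ∧
    ∃ c : ℝ,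
      IsGreatest (Set.range fun ω : ℝ =>
        sigmaMax ((S.transfer (-(Complex.I * (ω : ℂ))))ᵀ * S.transfer (Complex.I * (ω : ℂ)))) c ∧
      c < 1

/-- The plant `x' = A x + B₂ u + B₁ w`, `z = C₁ x + D₁₂ u`, `y = C₂ x + D₂₁ w` with
`x ∈ ℝⁿ`, `w, z ∈ ℝᵐ`, `u ∈ ℝ^q`, `y ∈ ℝ^p`. -/
structure Plant (n m q p : ℕ) where
  A : Matrix (Fin n) (Fin n) ℝ
  B₁ : Matrix (Fin n) (Fin m) ℝ
  B₂ : Matrix (Fin n) (Fin q) ℝ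
  C₁ : Matrix (Fin m) (Fin n) ℝ
  C₂ : Matrix (Fin p) (Fin n) ℝ
  D₁₂ : Matrix (Fin m) (Fin q) ℝ
  D₂₁ : Matrix (Fin p) (Fin m) ℝ

/-- The compensator `x_c' = A_c x_c + B_c y`, `u = C_c x_c` of order `k`. -/
structure Compensator (k q p : ℕ) where
  Ac : Matrix (Fin k) (Fin k) ℝ
  Bc : Matrix (Fin k) (Fin p) ℝ
  Cc : Matrix (Fin q) (Fin k) ℝ

namespace Plant

variable {n m q p : ℕ} (S : Plant n m q p)

/-- The closed loop from `w` to `z`, with state `(x, x_c)`. -/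
def closedLoop {k : ℕ} (K : Compensator k q p) : LTISystem (Fin n ⊕ Fin k) (Fin m) (Fin m) where
  A := Matrix.fromBlocks S.A (S.B₂ * K.Cc) (K.Bc * S.C₂) K.Ac
  B := Matrix.fromRows S.B₁ (K.Bc * S.D₂₁)
  C := Matrix.fromCols S.C₁ (S.D₁₂ * K.Cc)

/-- `E₁ = D₁₂ᵀ D₁₂`. -/
def E₁ : Matrix (Fin q) (Fin q) ℝ := S.D₁₂ᵀ * S.D₁₂

/-- `E₂ = D₂₁ D₂₁ᵀ`. -/
def E₂ : Matrix (Fin p) (Fin p) ℝ := S.D₂₁ * S.D₂₁ᵀ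

/-- `A - B₂ E₁⁻¹ D₁₂ᵀ C₁`. -/
def AX : Matrix (Fin n) (Fin n) ℝ := S.A - S.B₂ * S.E₁⁻¹ * S.D₁₂ᵀ * S.C₁

/-- `A - B₁ D₂₁ᵀ E₂⁻¹ C₂`. -/
def AY : Matrix (Fin n) (Fin n) ℝ := S.A - S.B₁ * S.D₂₁ᵀ * S.E₂⁻¹ * S.C₂

/-- `X` is a symmetric stabilizing solution of the control Riccati equation. -/
def IsStabilizingX (X : Matrix (Fin n) (Fin n) ℝ) : Prop :=
  Xᵀ = X ∧
  S.AXᵀ * X + X * S.AX + X * (S.B₁ * S.B₁ᵀ - S.B₂ * S.E₁⁻¹ * S.B₂ᵀ) * X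
    + S.C₁ᵀ * (1 - S.D₁₂ * S.E₁⁻¹ * S.D₁₂ᵀ) * S.C₁ = 0 ∧
  IsHurwitz (S.AX + (S.B₁ * S.B₁ᵀ - S.B₂ * S.E₁⁻¹ * S.B₂ᵀ) * X)

/-- `Y` is a symmetric stabilizing solution of the filter Riccati equation. -/
def IsStabilizingY (Y : Matrix (Fin n) (Fin n) ℝ) : Prop :=
  Yᵀ = Y ∧
  S.AY * Y + Y * S.AYᵀ + Y * (S.C₁ᵀ * S.C₁ - S.C₂ᵀ * S.E₂⁻¹ * S.C₂) * Y
    + S.B₁ * (1 - S.D₂₁ᵀ * S.E₂⁻¹ * S.D₂₁) * S.B₁ᵀ = 0 ∧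
  IsHurwitz (S.AY + Y * (S.C₁ᵀ * S.C₁ - S.C₂ᵀ * S.E₂⁻¹ * S.C₂))

/-- `B_c = -(Y C₂ᵀ + B₁ D₂₁ᵀ) E₂⁻¹`. -/
def Bc (Y : Matrix (Fin n) (Fin n) ℝ) : Matrix (Fin n) (Fin p) ℝ :=
  -((Y * S.C₂ᵀ + S.B₁ * S.D₂₁ᵀ) * S.E₂⁻¹)

/-- `C_c = E₁⁻¹ (B₂ᵀ X + D₁₂ᵀ C₁) (I - Y X)⁻¹`. -/
def Cc (X Y : Matrix (Fin n) (Fin n) ℝ) : Matrix (Fin q) (Fin n) ℝ :=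
  S.E₁⁻¹ * (S.B₂ᵀ * X + S.D₁₂ᵀ * S.C₁) * (1 - Y * X)⁻¹

/-- The compensator of order `n` built from `X` and `Y`, with
`A_c = A + B_c C₂ - B₂ C_c + Y C₁ᵀ (C₁ - D₁₂ C_c)`. -/
def compensator (X Y : Matrix (Fin n) (Fin n) ℝ) : Compensator n q p where
  Ac := S.A + S.Bc Y * S.C₂ - S.B₂ * S.Cc X Y + Y * S.C₁ᵀ * (S.C₁ - S.D₁₂ * S.Cc X Y)
  Bc := S.Bc Y
  Cc := S.Cc X Y

end Plant

end PseudoHinf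

end

noncomputable section

namespace PseudoHinf

open Filter Topology Module

/-! ### Sign of a dissipated form on a spectral subspace. -/

section Inertia

/-! Use the coordinates x + x_c (estimation error) and -x_c (state estimate), and put W = X⁻¹ - Y,
which is positive definite because ρ(XY) < 1. Then P = diag(Y, W) solves the bounded real Riccati
equation A P + P Aᵀ + P Cᵀ C P + B Bᵀ = 0 of the closed loop
(`isPseudoStrictBoundedReal_estimator`): the diagonal blocks are the filter equation for Y and an
equation for W obtained by comparing those of X⁻¹ and Y (`coupled_riccati`), and the off-diagonal
blocks vanish by the choice of the filter gain. P has exactly one negative square, that of Y.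

The matrix A + P Cᵀ C is block triangular. One diagonal block is the Hurwitz matrix of Y, the other
is similar to minus the transpose of the Hurwitz matrix of X, so there are no imaginary eigenvalues.
This suffices (`isPseudoStrictBoundedReal_of_riccati`): A has none either, the inequality A P + P Aᵀ
≤ 0 transfers the signature of P to the spectrum of A (`isPseudoHurwitz_of_lyapunov`), and an
identity G Gᴴ + K Kᴴ = I with K invertible bounds the transfer function on the imaginary axis. -/

lemma tendsto_zero_of_affine_recursion {V : Type*} [NormedAddCommGroup V] [NormedSpace ℂ V]
    {x y : ℕ → V} {μ : ℂ} (hμ : ‖μ‖ < 1) (hx : ∀ k, x (k + 1) = μ • x k + y k)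
    (hy : Tendsto y atTop (𝓝 0)) : Tendsto x atTop (𝓝 0) := by
  rw [Metric.tendsto_atTop] at hy ⊢
  intro ε hε
  have hr : 0 < 1 - ‖μ‖ := by linarith
  -- This tolerance makes `ε / 2` a fixed point of the bound: ‖μ‖ ε/2 + (1 - ‖μ‖) ε/2 = ε/2.
  obtain ⟨K, hK⟩ := hy ((1 - ‖μ‖) * (ε / 2)) (by positivity)
  have key : ∀ j, ‖x (K + j)‖ ≤ ‖μ‖ ^ j * ‖x K‖ + ε / 2 := by
    intro j
    induction j with
    | zero => simp; positivity
    | succ j ih =>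
      have h1 := hK (K + j) (by omega)
      rw [dist_zero_right] at h1
      calc ‖x (K + (j + 1))‖ = ‖μ • x (K + j) + y (K + j)‖ := by rw [← add_assoc, hx]
        _ ≤ ‖μ‖ * ‖x (K + j)‖ + ‖y (K + j)‖ := by
            simpa [norm_smul] using norm_add_le (μ • x (K + j)) (y (K + j))
        _ ≤ ‖μ‖ * (‖μ‖ ^ j * ‖x K‖ + ε / 2) + (1 - ‖μ‖) * (ε / 2) := by gcongr
        _ = _ := by ring
  have hlim : Tendsto (fun j => ‖μ‖ ^ j * ‖x K‖) atTop (𝓝 0) := by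
    simpa using (tendsto_pow_atTop_nhds_zero_of_lt_one (norm_nonneg μ) hμ).mul_const ‖x K‖
  obtain ⟨J, hJ⟩ := (hlim.eventually (gt_mem_nhds (half_pos hε))).exists_forall_of_atTop
  refine ⟨K + J, fun n hn => ?_⟩
  obtain ⟨j, rfl⟩ := Nat.exists_eq_add_of_le (show K ≤ n by omega)
  rw [dist_zero_right]
  linarith [key j, hJ j (by omega)]

lemma norm_cayley_lt_one {c : ℝ} (hc : 0 < c) {z : ℂ} (hz : 0 < z.re) :
    ‖(z - c) / (z + c)‖ < 1 := by
  have h0 : z + c ≠ 0 := by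
    intro h
    have := congrArg Complex.re h
    simp at this
    linarith
  rw [norm_div, div_lt_one (norm_pos_iff.mpr h0), ← sq_lt_sq₀ (norm_nonneg _) (norm_nonneg _),
    Complex.sq_norm, Complex.sq_norm, Complex.normSq_apply, Complex.normSq_apply]
  simp
  nlinarith

variable {V : Type*} [NormedAddCommGroup V] [NormedSpace ℂ V]

/-- The powers of the Cayley transform `(f - c)(f + c)⁻¹` annihilate in the limit the generalized
eigenspaces of `f` in the open right half-plane. -/
lemma tendsto_cayley_pow {f g : End ℂ V} {c : ℝ} (hc : 0 < c)
    (h₁ : g * (f + (c : ℂ) • 1) = 1) (h₂ : (f + (c : ℂ) • 1) * g = 1)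
    {z : ℂ} (hz : 0 < z.re) {v : V} (hv : v ∈ f.maxGenEigenspace z) :
    Tendsto (fun k => (((f - (c : ℂ) • 1) * g) ^ k : End ℂ V) v) atTop (𝓝 0) := by
  rw [End.mem_maxGenEigenspace] at hv
  obtain ⟨N, hN⟩ := hv
  have hcomm : Commute g f := by
    have h3 : g * f = 1 - (c : ℂ) • g := by
      rw [← h₁]; simp [mul_add]
    have h4 : f * g = 1 - (c : ℂ) • g := by
      rw [← h₂]; simp [add_mul]
    exact h3.trans h4.symm
  have h0 : z + c ≠ 0 := by
    intro h
    have := congrArg Complex.re h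
    simp at this
    linarith
  -- A scalar of modulus less than one plus a remainder containing f - z, which lowers the exponent
  -- `N` and feeds the induction.
  have hT : (f - (c : ℂ) • 1) * g
      = ((z - c) / (z + c)) • 1 + (2 * c / (z + c)) • (g * (f - z • 1)) := by
    have hfg : f * g = 1 - (c : ℂ) • g := by
      rw [← h₂]; simp [add_mul]
    have hgf : g * f = 1 - (c : ℂ) • g := by rw [hcomm.eq, hfg]
    rw [sub_mul, mul_sub, hfg, hgf]
    simp only [smul_mul_assoc, mul_smul_comm, one_mul, mul_one]
    match_scalars <;> field_simp <;> ring
  induction N generalizing v with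
  | zero =>
    have : v = 0 := by simpa using hN
    simp [this]
  | succ N ih =>
    have hw : ((f - z • 1) ^ N) ((2 * c / (z + c)) • (g * (f - z • 1)) v) = 0 := by
      have h5 : Commute ((f - z • 1) ^ N) g :=
        ((hcomm.symm.sub_left ((Commute.one_left g).smul_left z)).pow_left N)
      rw [map_smul, ← End.mul_apply, ← mul_assoc, h5.eq, mul_assoc, ← pow_succ,
        End.mul_apply, hN]
      simp
    refine tendsto_zero_of_affine_recursion (norm_cayley_lt_one hc hz) (fun k => ?_) (ih hw)
    rw [pow_succ, End.mul_apply]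
    nth_rewrite 2 [hT]
    simp [map_add]

/-- Taking w = (f + c)⁻¹ x in `hdiss` gives h x ≤ h (T x) for the Cayley transform T, a discrete
substitute for the flow exp(-t f). Hence h v ≤ h (T^k v), which tends to h 0 = 0. -/
lemma nonpos_of_mem_iSup_maxGenEigenspace [FiniteDimensional ℂ V] {f : End ℂ V} {h : V → ℝ}
    (hcont : Continuous h) (h0 : h 0 = 0)
    (hdiss : ∀ c : ℝ, 0 < c → ∀ w, h (f w + (c : ℂ) • w) ≤ h (f w - (c : ℂ) • w))
    {v : V} (hv : v ∈ ⨆ z : {z : ℂ // 0 < z.re}, f.maxGenEigenspace z) : h v ≤ 0 := by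
  obtain ⟨c, hc, hcf⟩ : ∃ c : ℝ, 0 < c ∧ (-(c : ℂ)) ∉ spectrum ℂ f := by
    have hfin : Set.Finite ((fun c : ℝ => (-(c : ℂ))) ⁻¹' spectrum ℂ f) :=
      (End.finite_spectrum f).preimage (fun a _ b _ hab => by simpa using hab)
    obtain ⟨c, hc, hc'⟩ := (Set.Ioi_infinite (0 : ℝ)).exists_notMem_finite hfin
    exact ⟨c, hc, hc'⟩
  have hu : IsUnit (f + (c : ℂ) • 1) := by
    rw [spectrum.notMem_iff] at hcf
    have e : -(f + (c : ℂ) • 1) = algebraMap ℂ (End ℂ V) (-(c : ℂ)) - f := by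
      rw [map_neg, Algebra.algebraMap_eq_smul_one]
      abel
    rw [← IsUnit.neg_iff, e]
    exact hcf
  obtain ⟨u, hu⟩ := hu
  set g : End ℂ V := ↑u⁻¹
  have h₁ : g * (f + (c : ℂ) • 1) = 1 := by rw [← hu]; simp [g]
  have h₂ : (f + (c : ℂ) • 1) * g = 1 := by rw [← hu]; simp [g]
  set T : End ℂ V := (f - (c : ℂ) • 1) * g with hT
  have hlim : Tendsto (fun k => (T ^ k) v) atTop (𝓝 0) := by
    refine Submodule.iSup_induction _ (motive := fun v => Tendsto (fun k => (T ^ k) v) atTop (𝓝 0))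
      hv (fun z x hx => tendsto_cayley_pow hc h₁ h₂ z.2 hx) ?_ ?_
    · simp
    · intro x y hx hy
      simpa using hx.add hy
  have hstep : ∀ x, h x ≤ h (T x) := by
    intro x
    have := hdiss c hc (g x)
    have hx : f (g x) + (c : ℂ) • g x = x := by
      simpa using congrArg (fun F : End ℂ V => F x) h₂
    rw [hx] at this
    simpa [hT] using this
  have hmono : ∀ k, h v ≤ h ((T ^ k) v) := by
    intro k
    induction k with
    | zero => simp
    | succ k ih => rw [pow_succ', End.mul_apply]; exact ih.trans (hstep _)
  have hl := (hcont.tendsto 0).comp hlim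
  rw [h0] at hl
  exact ge_of_tendsto' hl hmono

end Inertia

/-! ### Eigenvalue counts from dimensions of spectral subspaces. -/

section Counting

variable {V : Type*} [AddCommGroup V] [Module ℂ V] [FiniteDimensional ℂ V]

open Classical in
lemma finrank_iSup_maxGenEigenspace_le (f : End ℂ V) (p : ℂ → Prop) :
    finrank ℂ (⨆ z : {z : ℂ // p z}, f.maxGenEigenspace z : Submodule ℂ V)
      ≤ f.charpoly.roots.countP p := by
  have hsup : (⨆ z : {z : ℂ // p z}, f.maxGenEigenspace z : Submodule ℂ V)
      ≤ (f.charpoly.roots.toFinset.filter p).sup f.maxGenEigenspace := by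
    refine iSup_le fun z => ?_
    by_cases hz : z.1 ∈ f.charpoly.roots.toFinset
    · exact Finset.le_sup (f := f.maxGenEigenspace) (Finset.mem_filter.mpr ⟨hz, z.2⟩)
    · have : finrank ℂ (f.maxGenEigenspace z) = 0 := by
        rw [LinearMap.finrank_maxGenEigenspace_eq, ← Polynomial.count_roots]
        exact Multiset.count_eq_zero.mpr (by simpa using hz)
      rw [Submodule.finrank_eq_zero.mp this]
      exact bot_le
  have hle : ∀ s : Finset ℂ, finrank ℂ (s.sup f.maxGenEigenspace : Submodule ℂ V)
      ≤ ∑ z ∈ s, finrank ℂ (f.maxGenEigenspace z) := by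
    intro s
    induction s using Finset.induction_on with
    | empty => simp
    | insert a s ha ih =>
      rw [Finset.sup_insert, Finset.sum_insert ha]
      exact (Submodule.finrank_add_le_finrank_add_finrank _ _).trans (by gcongr)
  calc _ ≤ _ := Submodule.finrank_mono hsup
    _ ≤ _ := hle _
    _ = ∑ z ∈ (f.charpoly.roots.filter p).toFinset, (f.charpoly.roots.filter p).count z := by
      rw [Multiset.toFinset_filter]
      refine Finset.sum_congr rfl fun z hz => ?_
      rw [LinearMap.finrank_maxGenEigenspace_eq, ← Polynomial.count_roots,
        Multiset.count_filter_of_pos (Finset.mem_filter.mp hz).2]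
    _ = _ := by rw [Multiset.toFinset_sum_count_eq, Multiset.countP_eq_card_filter]

lemma card_roots_charpoly (f : End ℂ V) : Multiset.card f.charpoly.roots = finrank ℂ V := by
  rw [IsAlgClosed.card_roots_eq_natDegree, LinearMap.charpoly_natDegree]

open Classical in
/-- If the spectral subspaces of the two open half-planes have dimension at most `1` and at most
`dim V - 1`, and there is no spectrum on the imaginary axis, then the eigenvalues are counted
exactly. -/
lemma countP_roots_of_finrank_le (f : End ℂ V) (him : ∀ z ∈ f.charpoly.roots, z.re ≠ 0)
    (hpos : finrank ℂ (⨆ z : {z : ℂ // 0 < z.re}, f.maxGenEigenspace z : Submodule ℂ V) ≤ 1)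
    (hneg : finrank ℂ (⨆ z : {z : ℂ // z.re < 0}, f.maxGenEigenspace z : Submodule ℂ V)
      < finrank ℂ V) :
    f.charpoly.roots.countP (fun z => z.re < 0) + 1 = finrank ℂ V ∧
      f.charpoly.roots.countP (fun z => 0 < z.re) = 1 := by
  set Eu : Submodule ℂ V := ⨆ z : {z : ℂ // 0 < z.re}, f.maxGenEigenspace z
  set Es : Submodule ℂ V := ⨆ z : {z : ℂ // z.re < 0}, f.maxGenEigenspace z
  have htop : Eu ⊔ Es = ⊤ := by
    rw [eq_top_iff, ← End.iSup_maxGenEigenspace_eq_top f]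
    refine iSup_le fun z => ?_
    rcases lt_trichotomy z.re 0 with hz | hz | hz
    · exact le_sup_of_le_right (le_iSup (fun z : {z : ℂ // z.re < 0} => f.maxGenEigenspace z) ⟨z, hz⟩)
    · have : finrank ℂ (f.maxGenEigenspace z) = 0 := by
        rw [LinearMap.finrank_maxGenEigenspace_eq, ← Polynomial.count_roots]
        exact Multiset.count_eq_zero.mpr fun hmem => him z hmem hz
      rw [Submodule.finrank_eq_zero.mp this]
      exact bot_le
    · exact le_sup_of_le_left (le_iSup (fun z : {z : ℂ // 0 < z.re} => f.maxGenEigenspace z) ⟨z, hz⟩)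
  have h1 := Submodule.finrank_add_le_finrank_add_finrank Eu Es
  rw [htop, finrank_top] at h1
  have hu := finrank_iSup_maxGenEigenspace_le f (fun z => 0 < z.re)
  have hs := finrank_iSup_maxGenEigenspace_le f (fun z => z.re < 0)
  have hcard : f.charpoly.roots.countP (fun z => z.re < 0)
      + f.charpoly.roots.countP (fun z => 0 < z.re) = finrank ℂ V := by
    rw [← card_roots_charpoly f,
      Multiset.card_eq_countP_add_countP (fun z : ℂ => z.re < 0) f.charpoly.roots]
    congr 1
    refine Multiset.countP_congr rfl fun z hz => ?_
    have := him z hz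
    simp only [eq_iff_iff, not_lt]
    exact ⟨fun h => h.le, fun h => lt_of_le_of_ne h this.symm⟩
  -- Since Eu + Es = V, the bounds force dim Eu = 1 and dim Es = dim V - 1. The root counts dominate
  -- these dimensions and have the same sum, so they agree.
  change finrank ℂ Eu ≤ _ at hu
  change finrank ℂ Es ≤ _ at hs
  omega

end Counting

/-! ### Real matrices over ℂ and their eigenvalues. -/

section Complexification

variable {ι κ l : Type*}

@[simp] lemma toC_add (M N : Matrix ι κ ℝ) : toC (M + N) = toC M + toC N := by
  ext; simp [toC]

@[simp] lemma toC_sub (M N : Matrix ι κ ℝ) : toC (M - N) = toC M - toC N := by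
  ext; simp [toC]

@[simp] lemma toC_neg (M : Matrix ι κ ℝ) : toC (-M) = -toC M := by
  ext; simp [toC]

@[simp] lemma toC_zero : toC (0 : Matrix ι κ ℝ) = 0 := by
  ext; simp [toC]

@[simp] lemma toC_one [DecidableEq ι] : toC (1 : Matrix ι ι ℝ) = 1 := by
  simp [toC]

@[simp] lemma toC_mul [Fintype κ] (M : Matrix ι κ ℝ) (N : Matrix κ l ℝ) :
    toC (M * N) = toC M * toC N := by
  ext; simp [toC, Matrix.mul_apply]

@[simp] lemma toC_transpose (M : Matrix ι κ ℝ) : toC Mᵀ = (toC M)ᴴ := by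
  ext; simp [toC]

lemma transpose_toC (M : Matrix ι κ ℝ) : (toC M)ᵀ = (toC M)ᴴ := by
  ext; simp [toC]

lemma isUnit_toC [Fintype ι] [DecidableEq ι] {M : Matrix ι ι ℝ} (hM : IsUnit M) :
    IsUnit (toC M) := by
  obtain ⟨u, rfl⟩ := hM
  refine ⟨⟨toC u, toC ↑u⁻¹, ?_, ?_⟩, rfl⟩ <;> rw [← toC_mul] <;> simp

variable [Fintype ι] [DecidableEq ι]

lemma mem_eigs_iff_det {A : Matrix ι ι ℝ} {z : ℂ} :
    z ∈ eigs A ↔ (z • (1 : Matrix ι ι ℂ) - toC A).det = 0 := by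
  rw [eigs, Polynomial.mem_roots (toC A).charpoly_monic.ne_zero, Polynomial.IsRoot.def,
    Matrix.eval_charpoly, scalar_apply, smul_one_eq_diagonal]

lemma mem_eigs_iff {A : Matrix ι ι ℝ} {z : ℂ} :
    z ∈ eigs A ↔ ∃ v ≠ 0, toC A *ᵥ v = z • v := by
  rw [mem_eigs_iff_det, ← exists_mulVec_eq_zero_iff]
  simp only [sub_mulVec, smul_mulVec, one_mulVec, sub_eq_zero]
  exact exists_congr fun v => and_congr_right fun _ => eq_comm

lemma eigs_transpose (A : Matrix ι ι ℝ) : eigs Aᵀ = eigs A := by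
  rw [eigs, toC_transpose, ← transpose_toC, charpoly_transpose, eigs]

end Complexification

/-! ### The largest singular value as an operator norm. -/

section SingularValue

/-- An eigenvector of T*T for the square of the first singular value gives one inequality; expansion
in an eigenbasis of T*T gives the other. -/
lemma singularValues_zero_eq_norm {E F : Type*} [NormedAddCommGroup E] [InnerProductSpace ℂ E]
    [FiniteDimensional ℂ E] [NormedAddCommGroup F] [InnerProductSpace ℂ F]
    [FiniteDimensional ℂ F] (T : E →ₗ[ℂ] F) :
    T.singularValues 0 = ‖LinearMap.toContinuousLinearMap T‖ := by
  -- On a zero-dimensional space the singular value of index 0 is zero by convention.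
  rcases Nat.eq_zero_or_pos (finrank ℂ E) with h0 | hpos
  · have : Subsingleton E := finrank_zero_iff.mp h0
    rw [T.singularValues_of_finrank_le h0.le]
    have : T = 0 := LinearMap.ext fun x => by simp [Subsingleton.elim x 0]
    simp [this]
  have hsq : ∀ x, ‖T x‖ ^ 2 = RCLike.re (inner ℂ ((T.adjoint ∘ₗ T) x) x) := by
    intro x
    rw [LinearMap.comp_apply, LinearMap.adjoint_inner_left, inner_self_eq_norm_sq]
  apply le_antisymm
  · obtain ⟨v, hv⟩ := (T.hasEigenvalue_adjoint_comp_self_sq_singularValues hpos).exists_hasEigenvector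
    have hvn : 0 < ‖v‖ := norm_pos_iff.mpr hv.2
    have h1 := hsq v
    rw [hv.apply_eq_smul, inner_smul_left] at h1
    have h2 : ‖T v‖ ^ 2 = (T.singularValues 0 * ‖v‖) ^ 2 := by
      rw [h1, inner_self_eq_norm_sq_to_K, mul_pow]
      simp [← Complex.ofReal_pow]
    have h3 : ‖T v‖ = T.singularValues 0 * ‖v‖ :=
      (sq_eq_sq₀ (norm_nonneg _) (mul_nonneg (T.singularValues_nonneg 0) hvn.le)).mp h2
    have h4 := (LinearMap.toContinuousLinearMap T).le_opNorm v
    rw [LinearMap.coe_toContinuousLinearMap', h3] at h4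
    exact le_of_mul_le_mul_right h4 hvn
  · refine ContinuousLinearMap.opNorm_le_bound _ (T.singularValues_nonneg 0) fun x => ?_
    rw [LinearMap.coe_toContinuousLinearMap', ← sq_le_sq₀ (norm_nonneg _)
      (mul_nonneg (T.singularValues_nonneg 0) (norm_nonneg x)), hsq, mul_pow]
    set hT := T.isSymmetric_adjoint_comp_self
    set b := hT.eigenvectorBasis rfl
    rw [← b.sum_inner_mul_inner, ← b.sum_sq_norm_inner_right x, map_sum, Finset.mul_sum]
    refine Finset.sum_le_sum fun i _ => ?_
    have h5 : inner ℂ ((T.adjoint ∘ₗ T) x) (b i)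
        = (hT.eigenvalues rfl i : ℂ) * inner ℂ x (b i) := by
      rw [hT x (b i), hT.apply_eigenvectorBasis, inner_smul_right]
      rfl
    have h6 : hT.eigenvalues rfl i ≤ T.singularValues 0 ^ 2 := by
      rw [← T.sq_singularValues_fin rfl]
      exact pow_le_pow_left₀ (T.singularValues_nonneg _) (T.singularValues_antitone (Nat.zero_le _)) 2
    have h7 : RCLike.re (inner ℂ ((T.adjoint ∘ₗ T) x) (b i) * inner ℂ (b i) x)
        = hT.eigenvalues rfl i * ‖inner ℂ (b i) x‖ ^ 2 := by
      rw [h5, mul_assoc, ← inner_conj_symm x (b i), ← Complex.normSq_eq_conj_mul_self,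
        Complex.normSq_eq_norm_sq, ← Complex.ofReal_mul]
      rfl
    rw [h7]
    gcongr

open scoped Matrix.Norms.L2Operator ComplexOrder

variable {ι κ : Type*} [Fintype ι] [Fintype κ] [DecidableEq κ]

lemma sigmaMax_eq_norm (M : Matrix ι κ ℂ) : sigmaMax M = ‖M‖ := by
  rw [sigmaMax, singularValues_zero_eq_norm, l2_opNorm_def]
  rfl

variable [DecidableEq ι]

lemma exists_mulVec_eq_norm_sq_smul (M : Matrix ι κ ℂ) (hM : M ≠ 0) :
    ∃ v ≠ 0, (Mᴴ * M) *ᵥ v = ((‖M‖ ^ 2 : ℝ) : ℂ) • v := by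
  have hpos : 0 < finrank ℂ (EuclideanSpace ℂ κ) := by
    rw [finrank_euclideanSpace, Fintype.card_pos_iff]
    by_contra hne
    rw [not_nonempty_iff] at hne
    exact hM (Subsingleton.elim _ _)
  obtain ⟨v, hv⟩ := ((toEuclideanLin M).hasEigenvalue_adjoint_comp_self_sq_singularValues
    hpos).exists_hasEigenvector
  refine ⟨WithLp.ofLp v, fun h => hv.2 (by ext i; exact congrFun h i), ?_⟩
  have h1 := congrArg WithLp.ofLp hv.apply_eq_smul
  rw [← toEuclideanLin_conjTranspose_eq_adjoint] at h1
  rw [← sigmaMax_eq_norm]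
  simpa [sigmaMax, toLpLin_apply, ← mulVec_mulVec] using h1

/-- Evaluate the identity at v with G Gᴴ v = ‖G‖² v. Strictness comes from Kᴴ v ≠ 0. -/
lemma norm_lt_one_of_mul_conjTranspose {G : Matrix ι κ ℂ} {K : Matrix ι ι ℂ} (hK : IsUnit K)
    (h : G * Gᴴ + K * Kᴴ = 1) : ‖G‖ < 1 := by
  by_cases hG : G = 0
  · simp [hG]
  obtain ⟨v, hv, hv'⟩ := exists_mulVec_eq_norm_sq_smul Gᴴ (by simpa using hG)
  rw [l2_opNorm_conjTranspose, conjTranspose_conjTranspose] at hv'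
  have hv0 : 0 < (star v ⬝ᵥ v).re := (Complex.pos_iff.mp (dotProduct_star_self_pos_iff.mpr hv)).1
  have hKv : Kᴴ *ᵥ v ≠ 0 := by
    intro h0
    obtain ⟨u, hu⟩ := hK.star
    rw [star_eq_conjTranspose] at hu
    apply hv
    rw [← one_mulVec v, ← u.inv_mul, hu, ← mulVec_mulVec, h0, mulVec_zero]
  have hK0 : 0 < (star (Kᴴ *ᵥ v) ⬝ᵥ (Kᴴ *ᵥ v)).re :=
    (Complex.pos_iff.mp (dotProduct_star_self_pos_iff.mpr hKv)).1
  have h1 := congrArg (fun M => (star v ⬝ᵥ M *ᵥ v).re) h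
  simp only [add_mulVec, hv', one_mulVec, dotProduct_add, dotProduct_smul, ← mulVec_mulVec,
    smul_eq_mul, Complex.add_re, Complex.re_ofReal_mul] at h1
  rw [star_mulVec, conjTranspose_conjTranspose, ← dotProduct_mulVec] at hK0
  have h2 : ‖G‖ ^ 2 < 1 := by
    by_contra hcon
    push Not at hcon
    nlinarith
  exact (sq_lt_one_iff₀ (norm_nonneg _)).mp h2

end SingularValue

/-! ### Inertia from a Lyapunov inequality. -/

section LyapunovInertia

variable {ι : Type*} [Fintype ι]

/-- The real part of the sesquilinear form of `P` at `v`. -/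
def qform (P : Matrix ι ι ℂ) (v : ι → ℂ) : ℝ := (star v ⬝ᵥ P *ᵥ v).re

lemma qform_neg (P : Matrix ι ι ℂ) (v : ι → ℂ) : qform (-P) v = -qform P v := by
  simp [qform, neg_mulVec]

lemma continuous_qform (P : Matrix ι ι ℂ) : Continuous (qform P) := by
  unfold qform
  simp only [dotProduct, mulVec]
  fun_prop

/-- Only the cross terms survive. This turns the Lyapunov inequality into the hypothesis `hdiss` of
`nonpos_of_mem_iSup_maxGenEigenspace`. -/
lemma qform_add_sub_qform_sub (P N : Matrix ι ι ℂ) (c : ℝ) (w : ι → ℂ) :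
    qform P (N *ᵥ w + (c : ℂ) • w) - qform P (N *ᵥ w - (c : ℂ) • w)
      = 2 * c * qform (Nᴴ * P + P * N) w := by
  simp only [qform, star_add, star_sub, star_smul, mulVec_add, mulVec_sub, mulVec_smul,
    add_dotProduct, sub_dotProduct, dotProduct_add, dotProduct_sub, smul_dotProduct,
    dotProduct_smul, add_mulVec, ← mulVec_mulVec, smul_eq_mul, Complex.add_re, Complex.sub_re]
  rw [dotProduct_mulVec (star w) Nᴴ, star_mulVec, Complex.star_def, Complex.conj_ofReal]
  simp only [Complex.re_ofReal_mul, Complex.add_re, Complex.sub_re]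
  ring

variable [DecidableEq ι]

lemma qform_nonpos_of_lyapunov {N P : Matrix ι ι ℂ} (h : ∀ v, qform (Nᴴ * P + P * N) v ≤ 0)
    {v : ι → ℂ} (hv : v ∈ ⨆ z : {z : ℂ // 0 < z.re}, End.maxGenEigenspace (toLin' N) z) :
    qform P v ≤ 0 := by
  refine nonpos_of_mem_iSup_maxGenEigenspace (continuous_qform P) (by simp [qform])
    (fun c hc w => ?_) hv
  have h1 := qform_add_sub_qform_sub P N c w
  simp only [toLin'_apply]
  nlinarith [mul_nonneg hc.le (neg_nonneg.mpr (h w))]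

lemma maxGenEigenspace_le_neg {V : Type*} [AddCommGroup V] [Module ℂ V] (f : End ℂ V) (z : ℂ) :
    f.maxGenEigenspace z ≤ (-f).maxGenEigenspace (-z) := by
  intro v hv
  rw [End.mem_maxGenEigenspace] at hv ⊢
  obtain ⟨k, hk⟩ := hv
  refine ⟨k, ?_⟩
  have : -f - (-z) • (1 : End ℂ V) = -(f - z • 1) := by rw [neg_smul]; abel
  rw [this, neg_pow, End.mul_apply, hk, map_zero]

lemma qform_nonneg_of_lyapunov {N P : Matrix ι ι ℂ} (h : ∀ v, qform (Nᴴ * P + P * N) v ≤ 0)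
    {v : ι → ℂ} (hv : v ∈ ⨆ z : {z : ℂ // z.re < 0}, End.maxGenEigenspace (toLin' N) z) :
    0 ≤ qform P v := by
  have h1 : qform (-P) v ≤ 0 := by
    refine qform_nonpos_of_lyapunov (N := -N) (fun w => ?_) ?_
    · simpa using h w
    · suffices hle : (⨆ z : {z : ℂ // z.re < 0}, End.maxGenEigenspace (toLin' N) z)
          ≤ ⨆ z : {z : ℂ // 0 < z.re}, End.maxGenEigenspace (toLin' (-N)) z from hle hv
      refine iSup_le fun z => ?_
      rw [map_neg]
      exact (maxGenEigenspace_le_neg _ _).trans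
        (le_iSup (fun z : {z : ℂ // 0 < z.re} => End.maxGenEigenspace (-toLin' N) z)
          ⟨-z.1, by simpa using z.2⟩)
  rw [qform_neg] at h1
  linarith

/-- Inertia of a Lyapunov inequality whose solution has exactly one negative square. -/
theorem isPseudoHurwitz_of_lyapunov {A P : Matrix ι ι ℝ}
    (hlyap : ∀ v, qform (toC (A * P + P * Aᵀ)) v ≤ 0) (him : ∀ z ∈ eigs A, z.re ≠ 0)
    {v₀ : ι → ℂ} (hneg : qform (toC P) v₀ < 0) (g : Dual ℂ (ι → ℂ))
    (hpos : ∀ v ≠ 0, g v = 0 → 0 < qform (toC P) v) : IsPseudoHurwitz A := by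
  classical
  set N : Matrix ι ι ℂ := toC Aᵀ
  have hroots : (toLin' N).charpoly.roots = eigs A := by
    rw [Matrix.charpoly_toLin', ← eigs_transpose A, eigs]
  have hl : ∀ v, qform (Nᴴ * toC P + toC P * N) v ≤ 0 := fun v => by simpa [N] using hlyap v
  have h := countP_roots_of_finrank_le (toLin' N) (by rwa [hroots]) ?_ ?_
  · rw [hroots, finrank_fintype_fun_eq_card] at h
    rw [IsPseudoHurwitz]
    convert h
  -- The form is nonpositive on this subspace but positive on the nonzero vectors of ker g, so g is
  -- injective there.
  · set Eu : Submodule ℂ (ι → ℂ) := ⨆ z : {z : ℂ // 0 < z.re}, End.maxGenEigenspace (toLin' N) z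
    have hinj : Function.Injective (g.domRestrict Eu) := by
      rw [← LinearMap.ker_eq_bot, LinearMap.ker_eq_bot']
      intro x hx
      by_contra hne
      have h1 := hpos x (by simpa using hne) (by simpa using hx)
      have h2 := qform_nonpos_of_lyapunov hl x.2
      linarith
    simpa using LinearMap.finrank_le_finrank_of_injective hinj
  · refine Submodule.finrank_lt fun htop => ?_
    have := qform_nonneg_of_lyapunov hl (v := v₀) (by rw [htop]; trivial)
    linarith

end LyapunovInertia

/-! ### The bounded real Riccati equation. -/

section BoundedReal

open scoped Matrix.Norms.L2Operator ComplexOrder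

variable {ι μ ν : Type*} [Fintype ι] [Fintype μ] [Fintype ν]

lemma qform_mul_conjTranspose_nonneg (M : Matrix ι μ ℂ) (v : ι → ℂ) : 0 ≤ qform (M * Mᴴ) v :=
  (posSemidef_self_mul_conjTranspose M).re_dotProduct_nonneg v

lemma mulVec_eq_zero_of_qform_eq_zero (M : Matrix ι μ ℂ) {v : ι → ℂ} (h : qform (M * Mᴴ) v = 0) :
    Mᴴ *ᵥ v = 0 := by
  have h1 : qform (M * Mᴴ) v = ∑ i, ‖(Mᴴ *ᵥ v) i‖ ^ 2 := by
    rw [qform, ← mulVec_mulVec, dotProduct_mulVec, ← conjTranspose_conjTranspose M,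
      ← star_mulVec, conjTranspose_conjTranspose, dotProduct, Complex.re_sum]
    refine Finset.sum_congr rfl fun i _ => ?_
    rw [Pi.star_apply, Complex.star_def, ← Complex.normSq_eq_conj_mul_self, Complex.ofReal_re,
      Complex.normSq_eq_norm_sq]
  rw [h1, Finset.sum_eq_zero_iff_of_nonneg (fun _ _ => by positivity)] at h
  ext i
  simpa using h i (Finset.mem_univ i)

variable [DecidableEq ι] (S : LTISystem ι μ ν)

lemma transpose_transfer_neg {μ ν : Type*} (S : LTISystem ι μ ν) (ω : ℝ) :
    (S.transfer (-(Complex.I * (ω : ℂ))))ᵀ = (S.transfer (Complex.I * (ω : ℂ)))ᴴ := by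
  simp only [LTISystem.transfer, transpose_mul, conjTranspose_mul, transpose_nonsing_inv,
    conjTranspose_nonsing_inv, transpose_toC]
  congr 3
  simp [transpose_sub, transpose_toC, conjTranspose_sub, conjTranspose_smul]

/-- The quantity is ‖G(iω)‖², continuous because the resolvent has no pole on the axis, and it tends
to zero at infinity. -/
lemma exists_isGreatest_sigmaMax [DecidableEq μ] (h : ∀ z ∈ eigs S.A, z.re ≠ 0) :
    ∃ c : ℝ, IsGreatest (Set.range fun ω : ℝ =>
        sigmaMax ((S.transfer (-(Complex.I * (ω : ℂ))))ᵀ * S.transfer (Complex.I * (ω : ℂ)))) c := by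
  set F : ℝ → ℝ := fun ω =>
    sigmaMax ((S.transfer (-(Complex.I * (ω : ℂ))))ᵀ * S.transfer (Complex.I * (ω : ℂ))) with hF
  have hF' : F = fun ω : ℝ =>
      ‖S.transfer (Complex.I * (ω : ℂ))‖ * ‖S.transfer (Complex.I * (ω : ℂ))‖ := by
    funext ω
    rw [hF]
    simp only
    rw [sigmaMax_eq_norm, transpose_transfer_neg, l2_opNorm_conjTranspose_mul_self]
  have hG : ∀ s, S.transfer s = toC S.C * resolvent (toC S.A) s * toC S.B := by
    intro s
    rw [LTISystem.transfer, resolvent, nonsing_inv_eq_ringInverse, Algebra.algebraMap_eq_smul_one]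
  have hmul : Continuous fun R : Matrix ι ι ℂ => toC S.C * R * toC S.B := by fun_prop
  have hI : Continuous fun ω : ℝ => Complex.I * (ω : ℂ) := by fun_prop
  have hcont : Continuous F := by
    rw [hF']
    have : Continuous fun ω : ℝ => S.transfer (Complex.I * (ω : ℂ)) := by
      simp only [hG]
      refine hmul.comp (continuous_iff_continuousAt.mpr fun ω => ?_)
      have hu : IsUnit (algebraMap ℂ (Matrix ι ι ℂ) (Complex.I * ω) - toC S.A) := by
        rw [isUnit_iff_isUnit_det, isUnit_iff_ne_zero, Algebra.algebraMap_eq_smul_one, ne_eq,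
          ← mem_eigs_iff_det]
        exact fun hmem => h _ hmem (by simp)
      obtain ⟨u, hu⟩ := hu
      have h1 := NormedRing.inverse_continuousAt u
      rw [hu] at h1
      have h2 : Continuous fun ω : ℝ =>
          algebraMap ℂ (Matrix ι ι ℂ) (Complex.I * (ω : ℂ)) - toC S.A :=
        ((continuous_algebraMap ℂ (Matrix ι ι ℂ)).comp hI).sub continuous_const
      exact ContinuousAt.comp (f := fun ω : ℝ =>
        algebraMap ℂ (Matrix ι ι ℂ) (Complex.I * (ω : ℂ)) - toC S.A) h1 h2.continuousAt
    exact this.norm.mul this.norm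
  have hlim : Tendsto F (cocompact ℝ) (𝓝 0) := by
    rw [hF']
    have hI' : Tendsto (fun ω : ℝ => Complex.I * (ω : ℂ)) (cocompact ℝ)
        (Bornology.cobounded ℂ) := by
      rw [← Metric.cobounded_eq_cocompact, ← tendsto_norm_atTop_iff_cobounded]
      simp only [norm_mul, Complex.norm_I, one_mul, Complex.norm_real]
      exact tendsto_norm_cobounded_atTop
    have h1 : Tendsto (fun ω : ℝ => S.transfer (Complex.I * (ω : ℂ))) (cocompact ℝ) (𝓝 0) := by
      simp only [hG]
      have h2 := (hmul.tendsto 0).comp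
        ((spectrum.resolvent_tendsto_cobounded (𝕜 := ℂ) (toC S.A)).comp hI')
      rwa [Matrix.mul_zero, Matrix.zero_mul] at h2
    simpa using h1.norm.mul h1.norm
  have hmax : ∃ ω₀, ∀ ω, F ω ≤ F ω₀ := by
    by_cases hz : ∀ ω, F ω ≤ 0
    · refine ⟨0, fun ω => (hz ω).trans ?_⟩
      rw [hF']; positivity
    · push Not at hz
      obtain ⟨ω₁, hω₁⟩ := hz
      exact hcont.exists_forall_ge' ω₁ ((hlim.eventually (gt_mem_nhds hω₁)).mono fun _ hx => hx.le)
  obtain ⟨ω₀, h0⟩ := hmax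
  exact ⟨F ω₀, ⟨ω₀, rfl⟩, by rintro _ ⟨ω, rfl⟩; exact h0 ω⟩

variable {S} {P : Matrix ι ι ℝ}

/-- A nonsingular solution of the bounded real Riccati equation for which `A + P Cᵀ C` has no
imaginary eigenvalues excludes imaginary eigenvalues of `A`. -/
lemma eigs_re_ne_zero_of_riccati (hP : IsUnit P)
    (hric : S.A * P + P * S.Aᵀ + P * S.Cᵀ * (S.C * P) + S.B * S.Bᵀ = 0)
    (hcl : ∀ z ∈ eigs (S.A + P * S.Cᵀ * S.C), z.re ≠ 0) (hPs : Pᵀ = P) :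
    ∀ z ∈ eigs S.A, z.re ≠ 0 := by
  intro z hz hz0
  rw [← eigs_transpose, mem_eigs_iff, toC_transpose] at hz
  obtain ⟨v, hv, hvz⟩ := hz
  have hPs' : (toC P)ᴴ = toC P := by rw [← toC_transpose, hPs]
  have hric' := congrArg toC hric
  simp only [toC_add, toC_mul, toC_transpose, toC_zero] at hric'
  -- Pairing the equation with v kills the Lyapunov part, since star z + z = 0. Two nonnegative
  -- terms with sum zero remain, so C P v = 0 and Bᴴ v = 0.
  have hsum : qform (toC P * (toC S.C)ᴴ * (toC P * (toC S.C)ᴴ)ᴴ) v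
      + qform (toC S.B * (toC S.B)ᴴ) v = 0 := by
    have h1 := congrArg (fun M => qform M v) hric'
    have hvA : star v ᵥ* toC S.A = star (z • v) := by
      rw [← hvz, star_mulVec, conjTranspose_conjTranspose]
    have h2 : qform (toC S.A * toC P + toC P * (toC S.A)ᴴ) v = 0 := by
      rw [qform, add_mulVec, ← mulVec_mulVec, ← mulVec_mulVec, hvz, dotProduct_add,
        dotProduct_mulVec (star v) (toC S.A), hvA, mulVec_smul, star_smul, smul_dotProduct,
        dotProduct_smul, ← add_smul]
      have : star z + z = 0 := by
        apply Complex.ext <;> simp [hz0]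
      rw [this]; simp
    simp only [qform, add_mulVec, dotProduct_add, Complex.add_re, zero_mulVec, dotProduct_zero,
      Complex.zero_re] at h1 h2 ⊢
    rw [conjTranspose_mul, conjTranspose_conjTranspose, hPs']
    linarith
  have hC := mulVec_eq_zero_of_qform_eq_zero (toC P * (toC S.C)ᴴ) (v := v) (by
    linarith [qform_mul_conjTranspose_nonneg (toC P * (toC S.C)ᴴ) v,
      qform_mul_conjTranspose_nonneg (toC S.B) v])
  have hB := mulVec_eq_zero_of_qform_eq_zero (toC S.B) (v := v) (by
    linarith [qform_mul_conjTranspose_nonneg (toC P * (toC S.C)ᴴ) v,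
      qform_mul_conjTranspose_nonneg (toC S.B) v])
  rw [conjTranspose_mul, conjTranspose_conjTranspose, hPs', ← mulVec_mulVec] at hC
  -- Applied to v, the equation becomes A P v = -z P v; as C P v = 0, P v is an eigenvector of A + P
  -- Cᵀ C too.
  have h3 := congrArg (fun M => M *ᵥ v) hric'
  simp only [add_mulVec, ← mulVec_mulVec, hvz, hC, hB, mulVec_zero, zero_mulVec, add_zero,
    mulVec_smul] at h3
  refine hcl (-z) (mem_eigs_iff.mpr ⟨toC P *ᵥ v, ?_, ?_⟩) (by simp [hz0])
  · intro h0
    obtain ⟨u, hu⟩ := isUnit_toC hP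
    apply hv
    rw [← one_mulVec v, ← u.inv_mul, hu, ← mulVec_mulVec, h0, mulVec_zero]
  · simp only [toC_add, toC_mul, add_mulVec, ← mulVec_mulVec, hC, mulVec_zero, add_zero]
    rw [neg_smul]
    exact eq_neg_of_add_eq_zero_left h3

variable [DecidableEq ν]

/-- For imaginary s and a = sI - A, the equation reads a P + P aᴴ = P Cᵀ C P + B Bᵀ. Multiplying by
C a⁻¹ on the left and its adjoint on the right gives G Gᴴ + K Kᴴ = I with K = I - C a⁻¹ P Cᵀ. -/
lemma norm_transfer_lt_one_of_riccati [DecidableEq μ] (hPs : Pᵀ = P)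
    (hric : S.A * P + P * S.Aᵀ + P * S.Cᵀ * (S.C * P) + S.B * S.Bᵀ = 0)
    (hA : ∀ z ∈ eigs S.A, z.re ≠ 0)
    (hcl : ∀ z ∈ eigs (S.A + P * S.Cᵀ * S.C), z.re ≠ 0) (ω : ℝ) :
    ‖S.transfer (Complex.I * (ω : ℂ))‖ < 1 := by
  set s : ℂ := Complex.I * (ω : ℂ)
  have hs : s.re = 0 := by simp [s]
  have hPs' : (toC P)ᴴ = toC P := by rw [← toC_transpose, hPs]
  have hric' := congrArg toC hric
  simp only [toC_add, toC_mul, toC_transpose, toC_zero] at hric'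
  set a : Matrix ι ι ℂ := s • 1 - toC S.A with ha
  have hau : IsUnit a.det := by
    rw [isUnit_iff_ne_zero, ne_eq, ha, ← mem_eigs_iff_det]
    exact fun hmem => hA _ hmem hs
  have haH : aᴴ = -(s • 1) - (toC S.A)ᴴ := by
    have : star s = -s := by apply Complex.ext <;> simp [s]
    rw [ha, conjTranspose_sub, conjTranspose_smul, this, conjTranspose_one, neg_smul]
  have hkey : a * toC P + toC P * aᴴ
      = toC P * (toC S.C)ᴴ * (toC S.C * toC P) + toC S.B * (toC S.B)ᴴ := by
    rw [haH, ha, sub_mul, mul_sub, mul_neg, smul_mul_assoc, mul_smul_comm, one_mul, mul_one]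
    rw [← sub_eq_zero, ← neg_eq_zero, ← hric']
    abel
  have haR : a⁻¹ * a = 1 := nonsing_inv_mul a hau
  have haRH : aᴴ * (a⁻¹)ᴴ = 1 := by rw [← conjTranspose_mul, haR, conjTranspose_one]
  -- Since det(I - UV) = det(I - VU), K is singular only if s is an eigenvalue of A + P Cᵀ C.
  have hK : IsUnit (1 - toC S.C * a⁻¹ * (toC P * (toC S.C)ᴴ)) := by
    rw [isUnit_iff_isUnit_det, Matrix.mul_assoc, det_one_sub_mul_comm, isUnit_iff_ne_zero]
    intro h0
    refine hcl s (mem_eigs_iff_det.mpr ?_) hs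
    have : s • 1 - toC (S.A + P * S.Cᵀ * S.C)
        = a * (1 - a⁻¹ * (toC P * (toC S.C)ᴴ) * toC S.C) := by
      rw [mul_sub, mul_one, Matrix.mul_assoc a⁻¹, ← mul_assoc a, mul_nonsing_inv a hau, one_mul, ha]
      simp only [toC_add, toC_mul, toC_transpose]
      abel
    rw [this, det_mul, h0, mul_zero]
  refine norm_lt_one_of_mul_conjTranspose hK ?_
  have hRR : a⁻¹ * (toC P * (toC S.C)ᴴ * (toC S.C * toC P) + toC S.B * (toC S.B)ᴴ) * (a⁻¹)ᴴ
      = toC P * (a⁻¹)ᴴ + a⁻¹ * toC P := by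
    rw [← hkey, mul_add, add_mul, ← mul_assoc a⁻¹, haR, one_mul, mul_assoc a⁻¹, mul_assoc (toC P),
      haRH, mul_one]
  have h4 := congrArg (fun M => toC S.C * M * (toC S.C)ᴴ) hRR
  simp only [LTISystem.transfer, ← ha, conjTranspose_mul, conjTranspose_sub, conjTranspose_one,
    conjTranspose_conjTranspose, hPs', Matrix.mul_add, Matrix.add_mul, Matrix.sub_mul,
    Matrix.mul_sub, Matrix.one_mul, Matrix.mul_one,
    Matrix.mul_assoc] at h4 ⊢
  have h5 := sub_eq_zero.mpr h4
  rw [← sub_eq_zero, ← h5]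
  abel

/-- A sufficient condition for the pseudo strict bounded real property. -/
theorem isPseudoStrictBoundedReal_of_riccati [DecidableEq μ] (hP : IsUnit P) (hPs : Pᵀ = P)
    (hric : S.A * P + P * S.Aᵀ + P * S.Cᵀ * (S.C * P) + S.B * S.Bᵀ = 0)
    (hcl : ∀ z ∈ eigs (S.A + P * S.Cᵀ * S.C), z.re ≠ 0)
    {v₀ : ι → ℂ} (hneg : qform (toC P) v₀ < 0) (g : Dual ℂ (ι → ℂ))
    (hpos : ∀ v ≠ 0, g v = 0 → 0 < qform (toC P) v) : S.IsPseudoStrictBoundedReal := by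
  have hA := eigs_re_ne_zero_of_riccati hP hric hcl hPs
  refine ⟨isPseudoHurwitz_of_lyapunov (fun v => ?_) hA hneg g hpos, ?_⟩
  · have h1 : S.A * P + P * S.Aᵀ = -(P * S.Cᵀ * (P * S.Cᵀ)ᵀ + S.B * S.Bᵀ) := by
      rw [transpose_mul, transpose_transpose, hPs]
      exact eq_neg_of_add_eq_zero_left (by rw [← hric]; abel)
    rw [h1, toC_neg, qform_neg, toC_add, toC_mul, toC_mul S.B, toC_transpose (P * S.Cᵀ),
      toC_transpose S.B]
    have h2 := qform_mul_conjTranspose_nonneg (toC (P * S.Cᵀ)) v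
    have h3 := qform_mul_conjTranspose_nonneg (toC S.B) v
    simp only [qform, add_mulVec, dotProduct_add, Complex.add_re] at h2 h3 ⊢
    linarith
  · obtain ⟨c, hc⟩ := exists_isGreatest_sigmaMax S hA
    refine ⟨c, hc, ?_⟩
    obtain ⟨ω, hω⟩ := hc.1
    rw [← hω]
    simp only
    rw [sigmaMax_eq_norm, transpose_transfer_neg, l2_opNorm_conjTranspose_mul_self]
    have := norm_transfer_lt_one_of_riccati hPs hric hA hcl ω
    nlinarith [norm_nonneg (S.transfer (Complex.I * (ω : ℂ)))]

end BoundedReal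

/-! ### Completing the square, and signatures of forms. -/

section Algebra

section

variable {ι α β : Type*} [Fintype ι] [Fintype α] [Fintype β]

variable {A X Q : Matrix ι ι ℝ} {B : Matrix ι α ℝ} {C : Matrix β ι ℝ} {D : Matrix β α ℝ}
  {Ei : Matrix α α ℝ} {F : Matrix α ι ℝ}

/-- Completion of the square in a Riccati equation with a cross term. -/
lemma riccati_completion [DecidableEq α] [DecidableEq β] (hEi : Ei * (Dᵀ * D) = 1)
    (hEis : Eiᵀ = Ei) (hX : Xᵀ = X)
    (hF : F = -(Ei * (Bᵀ * X + Dᵀ * C))) :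
    (A + B * F)ᵀ * X + X * (A + B * F) + X * Q * X + (C + D * F)ᵀ * (C + D * F)
      = (A - B * Ei * Dᵀ * C)ᵀ * X + X * (A - B * Ei * Dᵀ * C) + X * (Q - B * Ei * Bᵀ) * X
        + Cᵀ * (1 - D * Ei * Dᵀ) * C := by
  have hcan : ∀ M : Matrix α ι ℝ, Ei * (Dᵀ * (D * M)) = M := fun M => by
    rw [← Matrix.mul_assoc Dᵀ, ← Matrix.mul_assoc, hEi, Matrix.one_mul]
  subst hF
  simp only [transpose_add, transpose_sub, transpose_neg, transpose_mul, transpose_transpose, hX,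
    hEis, Matrix.mul_add, Matrix.add_mul, Matrix.mul_sub, Matrix.sub_mul, Matrix.mul_neg,
    Matrix.neg_mul, Matrix.mul_assoc, hcan, Matrix.one_mul]
  abel

lemma riccati_gain_orthogonality [DecidableEq α] (hEi : Ei * (Dᵀ * D) = 1)
    (hEis : Eiᵀ = Ei) (hX : Xᵀ = X)
    (hF : F = -(Ei * (Bᵀ * X + Dᵀ * C))) : X * B + (C + D * F)ᵀ * D = 0 := by
  subst hF
  simp only [transpose_add, transpose_neg, transpose_mul, transpose_transpose, hX,
    hEis, Matrix.mul_add, Matrix.add_mul, Matrix.mul_neg,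
    Matrix.neg_mul, Matrix.mul_assoc, hEi, Matrix.mul_one]
  abel

lemma riccati_closed_loop (hF : F = -(Ei * (Bᵀ * X + Dᵀ * C))) :
    A + B * F + Q * X = A - B * Ei * Dᵀ * C + (Q - B * Ei * Bᵀ) * X := by
  subst hF
  simp only [Matrix.mul_add, Matrix.sub_mul, Matrix.mul_neg, Matrix.mul_assoc]
  abel

end

section Signature

variable {ι α : Type*} [Fintype ι] [Fintype α]

lemma qform_conj (M : Matrix ι α ℂ) (P : Matrix α α ℂ) (v : ι → ℂ) :
    qform (M * P * Mᴴ) v = qform P (Mᴴ *ᵥ v) := by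
  rw [qform, qform, ← mulVec_mulVec, ← mulVec_mulVec, star_mulVec, conjTranspose_conjTranspose,
    ← dotProduct_mulVec]

variable [DecidableEq ι]

lemma qform_diagonal (d : ι → ℝ) (v : ι → ℂ) :
    qform (toC (diagonal d)) v = ∑ i, d i * ‖v i‖ ^ 2 := by
  rw [qform, dotProduct, Complex.re_sum]
  refine Finset.sum_congr rfl fun i _ => ?_
  have h1 : toC (diagonal d) = diagonal fun i => (d i : ℂ) := by
    rw [toC, diagonal_map (by simp)]
  rw [h1, mulVec_diagonal, Pi.star_apply, mul_left_comm, Complex.star_def,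
    ← Complex.normSq_eq_conj_mul_self, ← Complex.ofReal_mul, Complex.ofReal_re,
    Complex.normSq_eq_norm_sq]

lemma exists_eq_mul_diagonal_mul_transpose {Y : Matrix ι ι ℝ} (h : Y.IsHermitian) :
    ∃ Q : Matrix ι ι ℝ, IsUnit Q ∧ Y = Q * diagonal h.eigenvalues * Qᵀ := by
  have hspec := h.spectral_theorem
  rw [Unitary.conjStarAlgAut_apply] at hspec
  exact ⟨h.eigenvectorUnitary.1, ⟨Unitary.toUnits h.eigenvectorUnitary, rfl⟩, hspec⟩

lemma exists_qform_eq_sum_eigenvalues {Y : Matrix ι ι ℝ} (h : Y.IsHermitian) :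
    ∃ Q : Matrix ι ι ℂ, IsUnit Q ∧
      ∀ v, qform (toC Y) v = ∑ i, h.eigenvalues i * ‖(Q *ᵥ v) i‖ ^ 2 := by
  obtain ⟨Q, hQ, hspec⟩ := exists_eq_mul_diagonal_mul_transpose h
  refine ⟨(toC Q)ᴴ, ?_, fun v => ?_⟩
  · rw [← star_eq_conjTranspose]
    exact (isUnit_toC hQ).star
  · rw [← qform_diagonal, ← qform_conj, ← toC_transpose, ← toC_mul, ← toC_mul, ← hspec]

lemma mulVec_ne_zero_of_isUnit {Q : Matrix ι ι ℂ} (hQ : IsUnit Q) {v : ι → ℂ} (hv : v ≠ 0) :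
    Q *ᵥ v ≠ 0 := fun h =>
  hv (Matrix.mulVec_injective_of_isUnit hQ (h.trans (mulVec_zero Q).symm))

lemma qform_pos_of_posDef {W : Matrix ι ι ℝ} (hW : W.PosDef) {v : ι → ℂ} (hv : v ≠ 0) :
    0 < qform (toC W) v := by
  obtain ⟨Q, hQ, hq⟩ := exists_qform_eq_sum_eigenvalues hW.1
  rw [hq]
  obtain ⟨i, hi⟩ := Function.ne_iff.mp (mulVec_ne_zero_of_isUnit hQ hv)
  have hpos := hW.eigenvalues_pos
  refine Finset.sum_pos' (fun j _ => mul_nonneg (hpos j).le (by positivity))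
    ⟨i, Finset.mem_univ i, mul_pos (hpos i) ?_⟩
  have := norm_pos_iff.mpr hi
  positivity

/-- The form of a pseudo-positive definite matrix has exactly one negative square. -/
lemma IsPseudoPosDef.signature {Y : Matrix ι ι ℝ} (hY : IsPseudoPosDef Y) :
    IsUnit Y ∧ (∃ v, qform (toC Y) v < 0) ∧
      ∃ g : Module.Dual ℂ (ι → ℂ), ∀ v ≠ 0, g v = 0 → 0 < qform (toC Y) v := by
  obtain ⟨h, hpos, hneg⟩ := hY
  obtain ⟨i₀, hi₀⟩ := Finset.card_eq_one.mp hneg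
  have hneg₀ : h.eigenvalues i₀ < 0 := by
    have := Finset.mem_singleton_self i₀
    rw [← hi₀] at this
    exact (Finset.mem_filter.mp this).2
  have hpos' : ∀ i, i ≠ i₀ → 0 < h.eigenvalues i := by
    have hsub : (Finset.univ.filter fun i => 0 < h.eigenvalues i) ⊆ Finset.univ.erase i₀ := by
      intro i hi
      refine Finset.mem_erase.mpr ⟨?_, Finset.mem_univ i⟩
      rintro rfl
      exact absurd (Finset.mem_filter.mp hi).2 (not_lt.mpr hneg₀.le)
    have heq := Finset.eq_of_subset_of_card_le hsub (by
      rw [Finset.card_erase_of_mem (Finset.mem_univ i₀), Finset.card_univ]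
      omega)
    intro i hi
    have : i ∈ Finset.univ.erase i₀ := Finset.mem_erase.mpr ⟨hi, Finset.mem_univ i⟩
    rw [← heq] at this
    exact (Finset.mem_filter.mp this).2
  obtain ⟨Q, hQ, hq⟩ := exists_qform_eq_sum_eigenvalues h
  refine ⟨?_, ?_, ?_⟩
  · rw [isUnit_iff_isUnit_det, isUnit_iff_ne_zero, h.det_eq_prod_eigenvalues]
    refine Finset.prod_ne_zero_iff.mpr fun i _ => ?_
    by_cases hi : i = i₀
    · subst hi
      exact_mod_cast hneg₀.ne
    · exact_mod_cast (hpos' i hi).ne'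
  · obtain ⟨v, hv⟩ := (Matrix.mulVec_surjective_iff_isUnit.mpr hQ) (Pi.single i₀ 1)
    refine ⟨v, ?_⟩
    rw [hq, hv, Finset.sum_eq_single i₀ (fun j _ hj => by simp [hj]) (by simp)]
    simpa using hneg₀
  -- The functional reads off the coordinate that carries the negative eigenvalue.
  · refine ⟨LinearMap.proj i₀ ∘ₗ Q.mulVecLin, fun v hv hgv => ?_⟩
    have hgv' : (Q *ᵥ v) i₀ = 0 := hgv
    rw [hq]
    obtain ⟨i, hi⟩ := Function.ne_iff.mp (mulVec_ne_zero_of_isUnit hQ hv)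
    have hne : i ≠ i₀ := by
      rintro rfl
      exact hi hgv'
    refine Finset.sum_pos' (fun j _ => ?_) ⟨i, Finset.mem_univ i, mul_pos (hpos' i hne) ?_⟩
    · by_cases hj : j = i₀
      · subst hj; simp [hgv']
      · exact mul_nonneg (hpos' j hj).le (by positivity)
    · have := norm_pos_iff.mpr hi
      positivity

/-- If `X` is positive definite and `ρ(XY) < 1`, then `X⁻¹ - Y` is positive definite. -/
lemma posDef_inv_sub_of_spectralRadius_lt_one {X Y : Matrix ι ι ℝ} (hX : X.PosDef) (hY : Yᵀ = Y)
    (hXY : spectralRadius ℂ (toC (X * Y)) < 1) : (X⁻¹ - Y).PosDef := by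
  obtain ⟨R, hR⟩ : ∃ R : Matrix ι ι ℝ, X = Rᵀ * R := by
    obtain ⟨Q, -, hQ⟩ := exists_eq_mul_diagonal_mul_transpose hX.1
    refine ⟨diagonal (fun i => √(hX.1.eigenvalues i)) * Qᵀ, ?_⟩
    rw [transpose_mul, transpose_transpose, diagonal_transpose, Matrix.mul_assoc Q,
      ← Matrix.mul_assoc (diagonal _), diagonal_mul_diagonal, ← Matrix.mul_assoc]
    simp only [Real.mul_self_sqrt (hX.eigenvalues_pos _).le]
    exact hQ
  have hRu : IsUnit R := by
    have := hX.isUnit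
    rw [hR] at this
    exact isUnit_of_mul_isUnit_right this
  have hRu' : IsUnit Rᵀ := by
    rw [isUnit_iff_isUnit_det, det_transpose, ← isUnit_iff_isUnit_det]
    exact hRu
  have hdet := (isUnit_iff_isUnit_det R).mp hRu
  have hH : (1 - R * Y * Rᵀ).IsHermitian := by
    rw [IsHermitian, conjTranspose_eq_transpose_of_trivial]
    simp [transpose_sub, transpose_mul, hY, mul_assoc]
  have hpd : (1 - R * Y * Rᵀ).PosDef := by
    rw [hH.posDef_iff_eigenvalues_pos]
    intro i
    set t := hH.eigenvalues i
    have hev := hH.mulVec_eigenvectorBasis i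
    set u : ι → ℝ := ⇑(hH.eigenvectorBasis i) with hu
    have hu0 : u ≠ 0 := by
      intro h0
      exact hH.eigenvectorBasis.orthonormal.ne_zero i (by ext j; exact congrFun h0 j)
    have hRYR : (R * Y * Rᵀ) *ᵥ u = (1 - t) • u := by
      rw [sub_mulVec, one_mulVec] at hev
      rw [sub_smul, one_smul, ← hev, sub_sub_cancel]
    set w : ι → ℝ := Rᵀ *ᵥ u with hw
    have hw0 : w ≠ 0 := fun h =>
      hu0 (Matrix.mulVec_injective_of_isUnit hRu' (h.trans (mulVec_zero Rᵀ).symm))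
    -- With X = Rᵀ R, the map Rᵀ carries eigenvectors of the symmetric R Y Rᵀ to eigenvectors of X
    -- Y. Hence |1 - t| < 1 and t > 0.
    have hXYw : (X * Y) *ᵥ w = (1 - t) • w := by
      rw [hw, ← mulVec_smul, ← hRYR, hR]
      simp only [mulVec_mulVec, Matrix.mul_assoc]
    have hmem : ((1 - t : ℝ) : ℂ) ∈ spectrum ℂ (toC (X * Y)) := by
      rw [mem_spectrum_iff_isRoot_charpoly, ← Polynomial.mem_roots
        (toC (X * Y)).charpoly_monic.ne_zero]
      refine mem_eigs_iff.mpr ⟨fun j => (w j : ℂ), ?_, ?_⟩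
      · intro h0
        exact hw0 (funext fun j => by simpa using congrFun h0 j)
      · ext j
        have := congrFun hXYw j
        simp only [mulVec, dotProduct, Pi.smul_apply, smul_eq_mul, toC, map_apply] at this ⊢
        exact_mod_cast this
    have hlt : (‖((1 - t : ℝ) : ℂ)‖₊ : ENNReal) < 1 :=
      (le_iSup₂ (f := fun k (_ : k ∈ spectrum ℂ (toC (X * Y))) => (‖k‖₊ : ENNReal)) _ hmem).trans_lt hXY
    have hlt' : ‖((1 - t : ℝ) : ℂ)‖ < 1 := by exact_mod_cast hlt
    rw [Complex.norm_real, Real.norm_eq_abs, abs_lt] at hlt'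
    linarith
  have hW : X⁻¹ - Y = (R⁻¹)  * (1 - R * Y * Rᵀ) * (R⁻¹)ᴴ := by
    rw [conjTranspose_eq_transpose_of_trivial, hR, Matrix.mul_inv_rev, mul_sub, sub_mul, mul_one,
      transpose_nonsing_inv, mul_assoc R, ← mul_assoc R⁻¹, nonsing_inv_mul R hdet, one_mul,
      mul_assoc, mul_nonsing_inv Rᵀ (by rwa [det_transpose]), mul_one]
  rw [hW]
  refine hpd.mul_mul_conjTranspose_same ?_
  have hRi : IsUnit R⁻¹ := (isUnit_nonsing_inv_iff).mpr hRu
  exact vecMul_injective_of_isUnit hRi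

end Signature

end Algebra

/-! ### Changes of coordinates and block structure. -/

section Similarity

variable {ι μ ν : Type*} [Fintype ι] [DecidableEq ι] [Fintype μ] [DecidableEq μ] [Fintype ν]

/-- The pseudo strict bounded real property is invariant under an involutive change of
coordinates. -/
lemma LTISystem.IsPseudoStrictBoundedReal.of_involution {S : LTISystem ι μ ν} {T : Matrix ι ι ℝ}
    (hT : T * T = 1)
    (h : (⟨T * S.A * T, T * S.B, S.C * T⟩ : LTISystem ι μ ν).IsPseudoStrictBoundedReal) :
    S.IsPseudoStrictBoundedReal := by
  have hTC : toC T * toC T = 1 := by rw [← toC_mul, hT, toC_one]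
  have h2 : (toC T)⁻¹ = toC T := inv_eq_left_inv hTC
  have heigs : eigs (T * S.A * T) = eigs S.A := by
    have h3 : (toC T * toC S.A * (toC T)⁻¹).charpoly = (toC S.A).charpoly :=
      charpoly_units_conj ⟨toC T, toC T, hTC, hTC⟩ (toC S.A)
    rw [eigs, toC_mul, toC_mul, eigs, ← h3, h2]
  have htr : ∀ s, (⟨T * S.A * T, T * S.B, S.C * T⟩ : LTISystem ι μ ν).transfer s
      = S.transfer s := by
    intro s
    have h1 : s • (1 : Matrix ι ι ℂ) - toC T * toC S.A * toC T
        = toC T * (s • 1 - toC S.A) * toC T := by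
      rw [mul_sub, sub_mul, mul_smul_comm, mul_one, smul_mul_assoc, hTC]
    simp only [LTISystem.transfer, toC_mul]
    rw [h1, Matrix.mul_inv_rev, Matrix.mul_inv_rev, h2]
    simp only [Matrix.mul_assoc]
    rw [← Matrix.mul_assoc (toC T) (toC T) (toC S.B), hTC, Matrix.one_mul,
      ← Matrix.mul_assoc (toC T) (toC T), hTC, Matrix.one_mul]
  obtain ⟨h1, c, h2⟩ := h
  refine ⟨?_, c, ?_⟩
  · simp only [IsPseudoHurwitz] at h1 ⊢
    rwa [← heigs]
  · simpa only [htr] using h2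

end Similarity

section BlockForms

variable {ι κ : Type*} [Fintype ι] [Fintype κ]

lemma qform_fromBlocks_diagonal (Y : Matrix ι ι ℝ) (W : Matrix κ κ ℝ) (v : ι ⊕ κ → ℂ) :
    qform (toC (fromBlocks Y 0 0 W)) v
      = qform (toC Y) (v ∘ Sum.inl) + qform (toC W) (v ∘ Sum.inr) := by
  have h1 : toC (fromBlocks Y 0 0 W) = fromBlocks (toC Y) 0 0 (toC W) := by
    rw [toC, fromBlocks_map]
    simp [toC]
  rw [h1, qform, fromBlocks_mulVec, dotProduct, Fintype.sum_sum_type]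
  simp [qform, dotProduct]

variable [DecidableEq ι] [DecidableEq κ]

lemma mem_eigs_fromBlocks_zero₁₂ {A : Matrix ι ι ℝ} {C : Matrix κ ι ℝ} {D : Matrix κ κ ℝ} {z : ℂ}
    (hz : z ∈ eigs (fromBlocks A 0 C D)) : z ∈ eigs A ∨ z ∈ eigs D := by
  have h1 : toC (fromBlocks A 0 C D) = fromBlocks (toC A) 0 (toC C) (toC D) := by
    rw [toC, fromBlocks_map]
    simp [toC]
  have h2 : z • (1 : Matrix (ι ⊕ κ) (ι ⊕ κ) ℂ) - toC (fromBlocks A 0 C D)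
      = fromBlocks (z • 1 - toC A) 0 (-toC C) (z • 1 - toC D) := by
    rw [h1, ← fromBlocks_one, fromBlocks_smul, sub_eq_add_neg, fromBlocks_neg, fromBlocks_add]
    simp [sub_eq_add_neg]
  rw [mem_eigs_iff_det, h2, det_fromBlocks_zero₁₂, mul_eq_zero] at hz
  rwa [mem_eigs_iff_det, mem_eigs_iff_det]

/-- A matrix similar to the negative transpose of a Hurwitz matrix is anti-Hurwitz. -/
lemma IsHurwitz.re_pos_of_intertwine {H N X : Matrix ι ι ℝ} (hH : IsHurwitz H) (hX : IsUnit X)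
    (h : X * N = -(Hᵀ * X)) : ∀ z ∈ eigs N, 0 < z.re := by
  intro z hz
  obtain ⟨v, hv, hvz⟩ := mem_eigs_iff.mp hz
  have h1 := congrArg (fun M => toC M *ᵥ v) h
  simp only [toC_mul, toC_neg, neg_mulVec, ← mulVec_mulVec, hvz, mulVec_smul] at h1
  have hmem : -z ∈ eigs Hᵀ :=
    mem_eigs_iff.mpr ⟨toC X *ᵥ v, mulVec_ne_zero_of_isUnit (isUnit_toC hX) hv, by
      rw [neg_smul, h1, neg_neg]⟩
  rw [eigs_transpose] at hmem
  have := hH _ hmem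
  simp at this
  exact this

end BlockForms

/-- The bounded real property of the closed loop in the coordinates `(x + x_c, -x_c)`, with
estimator gain `L` and state feedback `F`. -/
lemma isPseudoStrictBoundedReal_estimator {ι μ ν π : Type*} [Fintype ι] [DecidableEq ι]
    [Fintype μ] [DecidableEq μ] [Fintype ν] [DecidableEq ν] [Fintype π]
    {AL M W Y : Matrix ι ι ℝ} {L : Matrix ι π ℝ} {C₁ CF : Matrix ν ι ℝ} {C₂ : Matrix π ι ℝ}
    {BL : Matrix ι μ ℝ} {D : Matrix π μ ℝ}
    (hYs : Yᵀ = Y) (hYp : IsPseudoPosDef Y) (hW : W.PosDef)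
    (hricY : AL * Y + Y * ALᵀ + Y * C₁ᵀ * (C₁ * Y) + BL * BLᵀ = 0)
    (horth : C₂ * Y + D * BLᵀ = 0)
    (hricW : M * W + W * Mᵀ + W * CFᵀ * (CF * W) + L * D * (L * D)ᵀ = 0)
    (hYst : IsHurwitz (AL + Y * C₁ᵀ * C₁))
    (hWst : ∀ z ∈ eigs (M + W * CFᵀ * CF), 0 < z.re) :
    (⟨fromBlocks AL (-(Y * C₁ᵀ * CF)) (-(L * C₂)) M, fromRows BL (-(L * D)), fromCols C₁ CF⟩ :
      LTISystem (ι ⊕ ι) μ ν).IsPseudoStrictBoundedReal := by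
  have hWs : Wᵀ = W := hW.1
  obtain ⟨hYu, ⟨y, hy⟩, g, hg⟩ := hYp.signature
  have horth' : L * C₂ * Y + L * D * BLᵀ = 0 := by
    rw [Matrix.mul_assoc, Matrix.mul_assoc, ← Matrix.mul_add, horth, Matrix.mul_zero]
  have horthT : Y * (L * C₂)ᵀ + BL * (L * D)ᵀ = 0 := by
    have := congrArg transpose horth'
    simpa only [transpose_add, transpose_mul, transpose_transpose, hYs, transpose_zero,
      Matrix.mul_assoc] using this
  have hPC : fromBlocks Y 0 0 W * (fromCols C₁ CF)ᵀ = fromRows (Y * C₁ᵀ) (W * CFᵀ) := by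
    rw [transpose_fromCols, fromBlocks_mul_fromRows]
    simp
  have hCP : fromCols C₁ CF * fromBlocks Y 0 0 W = fromCols (C₁ * Y) (CF * W) := by
    rw [fromCols_mul_fromBlocks]
    simp
  refine isPseudoStrictBoundedReal_of_riccati (P := fromBlocks Y 0 0 W) ?_ ?_ ?_ ?_
    (v₀ := Sum.elim y 0) ?_ (g ∘ₗ LinearMap.funLeft ℂ ℂ Sum.inl) ?_
  · rw [isUnit_iff_isUnit_det, det_fromBlocks_zero₁₂]
    exact ((isUnit_iff_isUnit_det _).mp hYu).mul ((isUnit_iff_isUnit_det _).mp hW.isUnit)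
  · rw [fromBlocks_transpose, hYs, hWs]
    simp
  · simp only [hPC, hCP]
    rw [fromRows_mul_fromCols, transpose_fromRows, fromRows_mul_fromCols, fromBlocks_transpose,
      fromBlocks_multiply, fromBlocks_multiply, fromBlocks_add, fromBlocks_add, fromBlocks_add,
      ← fromBlocks_zero]
    congr 1
    · simpa using hricY
    -- The quadratic term cancels the coupling through Y C₁ᵀ CF, leaving the orthogonality relation.
    · refine neg_eq_zero.mp (Eq.trans ?_ horthT)
      simp only [transpose_neg, Matrix.mul_neg, Matrix.neg_mul, Matrix.mul_zero, Matrix.zero_mul,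
        Matrix.mul_assoc]
      abel
    · refine neg_eq_zero.mp (Eq.trans ?_ horth')
      simp only [transpose_neg, transpose_mul, transpose_transpose, hYs, Matrix.mul_neg,
        Matrix.neg_mul, Matrix.mul_zero, Matrix.zero_mul, Matrix.mul_assoc]
      abel
    · simpa using hricW
  · intro z hz
    simp only [hPC] at hz
    -- The same cancellation makes A + P Cᵀ C block lower triangular.
    rw [fromRows_mul_fromCols, fromBlocks_add, neg_add_cancel] at hz
    rcases mem_eigs_fromBlocks_zero₁₂ hz with hz | hz
    · exact (hYst z hz).ne
    · exact (hWst z hz).ne'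
  · rw [qform_fromBlocks_diagonal]
    simpa [qform] using hy
  · intro v hv hgv
    rw [qform_fromBlocks_diagonal]
    have hgv' : g (v ∘ Sum.inl) = 0 := hgv
    by_cases h1 : v ∘ Sum.inl = 0
    · have h2 : v ∘ Sum.inr ≠ 0 := by
        intro h2
        apply hv
        ext (i | i)
        · exact congrFun h1 i
        · exact congrFun h2 i
      have := qform_pos_of_posDef hW h2
      rw [h1]
      simpa [qform] using this
    · have h3 := hg _ h1 hgv'
      by_cases h2 : v ∘ Sum.inr = 0
      · rw [h2]
        simpa [qform] using h3
      · exact add_pos h3 (qform_pos_of_posDef hW h2)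

/-! ### Coupling the two Riccati equations. -/

lemma mul_cancel_left_of_mul_eq_one {ι κ : Type*} [Fintype ι] [DecidableEq ι]
    {U X : Matrix ι ι ℝ} (h : U * X = 1) (Z : Matrix ι κ ℝ) : U * (X * Z) = Z := by
  rw [← Matrix.mul_assoc, h, Matrix.one_mul]

/-- The Riccati identity and the closed-loop intertwining for `W = X⁻¹ - Y`. -/
lemma coupled_riccati {ι μ ν α : Type*} [Fintype ι] [DecidableEq ι] [Fintype μ] [Fintype ν]
    [Fintype α] {A X U Y V : Matrix ι ι ℝ} {B₁ : Matrix ι μ ℝ} {B₂ : Matrix ι α ℝ}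
    {C₁ : Matrix ν ι ℝ} {D : Matrix ν α ℝ} {F F₀ : Matrix α ι ℝ}
    (hXU : X * U = 1) (hUX : U * X = 1) (hUs : Uᵀ = U) (hYs : Yᵀ = Y)
    (hF : F * (U - Y) = F₀ * U)
    (hX : (A + B₂ * F₀)ᵀ * X + X * (A + B₂ * F₀) + X * (B₁ * B₁ᵀ) * X
      + (C₁ + D * F₀)ᵀ * (C₁ + D * F₀) = 0)
    (horth : X * B₂ + (C₁ + D * F₀)ᵀ * D = 0)
    (hY : A * Y + Y * Aᵀ + Y * (C₁ᵀ * C₁) * Y + B₁ * B₁ᵀ = V) :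
    (A + B₂ * F + Y * C₁ᵀ * (C₁ + D * F)) * (U - Y)
        + (U - Y) * (A + B₂ * F + Y * C₁ᵀ * (C₁ + D * F))ᵀ
        + (U - Y) * (C₁ + D * F)ᵀ * ((C₁ + D * F) * (U - Y)) + V = 0 ∧
      (A + B₂ * F + Y * C₁ᵀ * (C₁ + D * F) + (U - Y) * (C₁ + D * F)ᵀ * (C₁ + D * F)) * (U - Y)
        = -(U * ((A + B₂ * F₀ + B₁ * B₁ᵀ * X)ᵀ * X) * (U - Y)) := by
  set AK := A + B₂ * F₀ with hAK
  set CK := C₁ + D * F₀ with hCK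
  set W := U - Y with hW
  have hWs : Wᵀ = W := by rw [hW, transpose_sub, hUs, hYs]
  -- F enters only through F W = F₀ U, so (I - YX)⁻¹ never has to be expanded.
  have hCF : (C₁ + D * F) * W = CK * U - C₁ * Y := by
    rw [Matrix.add_mul, Matrix.mul_assoc D, hF, hCK, hW]
    simp only [Matrix.add_mul, Matrix.mul_sub, Matrix.mul_assoc]
    abel
  have hCFt : W * (C₁ + D * F)ᵀ = U * CKᵀ - Y * C₁ᵀ := by
    have := congrArg transpose hCF
    rwa [transpose_mul, hWs, transpose_sub, transpose_mul, transpose_mul, hUs, hYs] at this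
  have hMW : (A + B₂ * F + Y * C₁ᵀ * (C₁ + D * F)) * W
      = AK * U - A * Y + Y * C₁ᵀ * (CK * U - C₁ * Y) := by
    rw [Matrix.add_mul, Matrix.add_mul, Matrix.mul_assoc (Y * C₁ᵀ), hCF, Matrix.mul_assoc B₂, hF,
      hAK, hW]
    simp only [Matrix.add_mul, Matrix.mul_sub, Matrix.mul_assoc]
    abel
  have hMWt : W * (A + B₂ * F + Y * C₁ᵀ * (C₁ + D * F))ᵀ
      = U * AKᵀ - Y * Aᵀ + (U * CKᵀ - Y * C₁ᵀ) * (C₁ * Y) := by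
    have := congrArg transpose hMW
    rw [transpose_mul, hWs] at this
    rw [this]
    simp only [transpose_add, transpose_sub, transpose_mul, transpose_transpose, hUs, hYs]
  have hX' : U * AKᵀ + AK * U + B₁ * B₁ᵀ + U * CKᵀ * (CK * U) = 0 := by
    have := congrArg (fun Z => U * Z * U) hX
    simp only [Matrix.mul_add, Matrix.add_mul, Matrix.mul_assoc,
      mul_cancel_left_of_mul_eq_one hUX, hXU, Matrix.mul_one,
      Matrix.mul_zero, Matrix.zero_mul] at this
    simpa only [Matrix.mul_assoc] using this
  have hX'' : U * AKᵀ * X + AK + B₁ * B₁ᵀ * X + U * CKᵀ * CK = 0 := by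
    have := congrArg (fun Z => U * Z) hX
    simp only [Matrix.mul_add, Matrix.mul_assoc,
      mul_cancel_left_of_mul_eq_one hUX, Matrix.mul_zero] at this
    simpa only [Matrix.mul_assoc] using this
  have hB : B₂ + U * CKᵀ * D = 0 := by
    have := congrArg (fun Z => U * Z) horth
    simp only [Matrix.mul_add,
      mul_cancel_left_of_mul_eq_one hUX, Matrix.mul_zero] at this
    simpa only [Matrix.mul_assoc] using this
  constructor
  -- Once V is replaced by its expression in Y, all terms in Y cancel and the equation for U = X⁻¹
  -- remains.
  · rw [hMW, hMWt, hCF, hCFt, ← hY, ← hX']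
    simp only [Matrix.mul_sub, Matrix.sub_mul, Matrix.mul_assoc]
    abel
  -- Orthogonality removes the feedback F₀, so both sides of the intertwining become AK U + U CKᵀ CK
  -- U - (A + U CKᵀ C₁) Y.
  · have h1 : AK + U * CKᵀ * CK = A + U * CKᵀ * C₁ := by
      have : AK + U * CKᵀ * CK = A + U * CKᵀ * C₁ + (B₂ + U * CKᵀ * D) * F₀ := by
        conv_lhs => rw [hAK]; enter [2, 2]; rw [hCK]
        simp only [Matrix.mul_add, Matrix.add_mul, Matrix.mul_assoc]
        abel
      rw [this, hB, Matrix.zero_mul, add_zero]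
    have h2 : U * AKᵀ * X + B₁ * B₁ᵀ * X = -(A + U * CKᵀ * C₁) := by
      rw [← h1]
      exact eq_neg_of_add_eq_zero_left (by rw [← hX'']; abel)
    have h3 : U * AKᵀ + B₁ * B₁ᵀ = -(AK * U + U * CKᵀ * (CK * U)) :=
      eq_neg_of_add_eq_zero_left (by rw [← hX']; abel)
    have hXs : Xᵀ = X := by
      have : X = U⁻¹ := (inv_eq_left_inv hXU).symm
      rw [this, transpose_nonsing_inv, hUs]
    have h4 : U * ((AK + B₁ * B₁ᵀ * X)ᵀ * X) * W
        = (U * AKᵀ + B₁ * B₁ᵀ) - (U * AKᵀ * X + B₁ * B₁ᵀ * X) * Y := by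
      rw [hW]
      simp only [transpose_add, transpose_mul, transpose_transpose, hXs, Matrix.mul_add,
        Matrix.add_mul, Matrix.mul_sub, Matrix.mul_assoc, hXU,
        mul_cancel_left_of_mul_eq_one hUX, Matrix.mul_one]
    rw [h4, h2, h3, Matrix.add_mul, hMW, hCFt, Matrix.mul_assoc _ _ W, hCF]
    simp only [Matrix.mul_sub, Matrix.sub_mul, Matrix.add_mul, Matrix.neg_mul, Matrix.mul_assoc]
    abel

/-! ### The closed loop with the explicit compensator. -/

namespace Plant

variable {n m q p : ℕ} (S : Plant n m q p)

theorem isPseudoStrictBoundedReal_closedLoop_compensator (hE₁ : S.E₁.PosDef) (hE₂ : S.E₂.PosDef)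
    {X Y : Matrix (Fin n) (Fin n) ℝ} (hX : S.IsStabilizingX X) (hXpos : X.PosDef)
    (hY : S.IsStabilizingY Y) (hYpos : IsPseudoPosDef Y)
    (hXY : spectralRadius ℂ (toC (X * Y)) < 1) :
    IsUnit (1 - Y * X) ∧ (S.closedLoop (S.compensator X Y)).IsPseudoStrictBoundedReal := by
  obtain ⟨hXs, hXric, hXst⟩ := hX
  obtain ⟨hYs, hYric, hYst⟩ := hY
  have hW := posDef_inv_sub_of_spectralRadius_lt_one hXpos hYs hXY
  have hXdet := (isUnit_iff_isUnit_det X).mp hXpos.isUnit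
  have hXU : X * X⁻¹ = 1 := mul_nonsing_inv X hXdet
  have hUX : X⁻¹ * X = 1 := nonsing_inv_mul X hXdet
  have hUs : (X⁻¹)ᵀ = X⁻¹ := by rw [transpose_nonsing_inv, hXs]
  have hWX : 1 - Y * X = (X⁻¹ - Y) * X := by rw [sub_mul, hUX]
  have hunit : IsUnit (1 - Y * X) := by
    rw [hWX]
    exact hW.isUnit.mul hXpos.isUnit
  refine ⟨hunit, ?_⟩
  have hZdet := (isUnit_iff_isUnit_det _).mp hunit
  have hE₁i : S.E₁⁻¹ * (S.D₁₂ᵀ * S.D₁₂) = 1 :=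
    nonsing_inv_mul _ ((isUnit_iff_isUnit_det _).mp hE₁.isUnit)
  have hE₁s : (S.E₁⁻¹)ᵀ = S.E₁⁻¹ := by
    rw [transpose_nonsing_inv, E₁, transpose_mul, transpose_transpose]
  have hE₂i : S.E₂⁻¹ * (S.D₂₁ᵀᵀ * S.D₂₁ᵀ) = 1 :=
    nonsing_inv_mul _ ((isUnit_iff_isUnit_det _).mp hE₂.isUnit)
  have hE₂s : (S.E₂⁻¹)ᵀ = S.E₂⁻¹ := by
    rw [transpose_nonsing_inv, E₂, transpose_mul, transpose_transpose]
  set F₀ : Matrix (Fin q) (Fin n) ℝ := -(S.E₁⁻¹ * (S.B₂ᵀ * X + S.D₁₂ᵀ * S.C₁)) with hF₀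
  set F : Matrix (Fin q) (Fin n) ℝ := F₀ * (1 - Y * X)⁻¹ with hFdef
  -- The sign arises because the estimate is -x_c: the control is u = F (-x_c).
  have hCc : S.Cc X Y = -F := by
    rw [Cc, hFdef, hF₀, Matrix.neg_mul, neg_neg]
  set L := S.Bc Y with hL
  have hLt : Lᵀ = -(S.E₂⁻¹ * (S.C₂ᵀᵀ * Y + S.D₂₁ᵀᵀ * S.B₁ᵀ)) := by
    rw [hL, Bc, transpose_neg, transpose_mul, hE₂s, transpose_add, transpose_mul, transpose_mul,
      hYs]
  have hFW : F * (X⁻¹ - Y) = F₀ * X⁻¹ := by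
    have h1 : X⁻¹ - Y = (1 - Y * X) * X⁻¹ := by rw [sub_mul, one_mul, mul_assoc, hXU, mul_one]
    rw [hFdef, h1, Matrix.mul_assoc, ← mul_assoc (1 - Y * X)⁻¹, nonsing_inv_mul _ hZdet, one_mul]
  have hXc := riccati_completion (A := S.A) (Q := S.B₁ * S.B₁ᵀ) hE₁i hE₁s hXs hF₀
  rw [← AX.eq_1, hXric] at hXc
  have hXo := riccati_gain_orthogonality hE₁i hE₁s hXs hF₀
  have hXcl := riccati_closed_loop (A := S.A) (Q := S.B₁ * S.B₁ᵀ) hF₀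
  have hAYt : S.Aᵀ - S.C₂ᵀ * S.E₂⁻¹ * S.D₂₁ᵀᵀ * S.B₁ᵀ = S.AYᵀ := by
    rw [AY, transpose_sub, transpose_mul, transpose_mul, transpose_mul, hE₂s]
    simp only [Matrix.mul_assoc]
  -- Duality: the filter equation is the control equation for Aᵀ, C₂ᵀ, B₁ᵀ, D₂₁ᵀ, with feedback gain
  -- Lᵀ.
  have hYc := riccati_completion (A := S.Aᵀ) (Q := S.C₁ᵀ * S.C₁) hE₂i hE₂s hYs hLt
  have hYo := riccati_gain_orthogonality hE₂i hE₂s hYs hLt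
  have hYcl := riccati_closed_loop (A := S.Aᵀ) (Q := S.C₁ᵀ * S.C₁) hLt
  rw [hAYt] at hYc hYcl
  simp only [transpose_transpose] at hYc hYo hYcl
  rw [hYric] at hYc
  have hBLt : S.B₁ᵀ + S.D₂₁ᵀ * Lᵀ = (S.B₁ + L * S.D₂₁)ᵀ := by
    rw [transpose_add, transpose_mul]
  have hALt : S.Aᵀ + S.C₂ᵀ * Lᵀ = (S.A + L * S.C₂)ᵀ := by
    rw [transpose_add, transpose_mul]
  rw [hBLt, hALt, transpose_transpose, transpose_transpose] at hYc
  rw [hBLt, transpose_transpose] at hYo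
  rw [hALt] at hYcl
  have horth : S.C₂ * Y + S.D₂₁ * (S.B₁ + L * S.D₂₁)ᵀ = 0 := by
    have := congrArg transpose hYo
    simpa only [transpose_add, transpose_mul, transpose_transpose, hYs, transpose_zero] using this
  have hV : S.A * Y + Y * S.Aᵀ + Y * (S.C₁ᵀ * S.C₁) * Y + S.B₁ * S.B₁ᵀ
      = L * S.D₂₁ * (L * S.D₂₁)ᵀ := by
    have h1 := congrArg (fun Z => L * Z) horth
    have h2 := congrArg transpose h1
    simp only [transpose_add, transpose_mul, transpose_transpose, hYs, transpose_zero,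
      Matrix.mul_add, Matrix.add_mul, Matrix.mul_zero, Matrix.mul_assoc] at h1 h2 hYc ⊢
    -- The three zeros become the completed filter equation, L times the orthogonality relation, and
    -- its transpose; the claim is their difference.
    have h3 : (0 : Matrix (Fin n) (Fin n) ℝ) - 0 - 0 = 0 := by simp
    rw [← sub_eq_zero, ← h3]
    nth_rewrite 1 [← hYc]
    nth_rewrite 1 [← h1]
    nth_rewrite 1 [← h2]
    abel
  obtain ⟨hric, hint⟩ := coupled_riccati hXU hUX hUs hYs hFW hXc hXo hV
  set M := S.A + S.B₂ * F + Y * S.C₁ᵀ * (S.C₁ + S.D₁₂ * F) with hM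
  have hN : X * (M + (X⁻¹ - Y) * (S.C₁ + S.D₁₂ * F)ᵀ * (S.C₁ + S.D₁₂ * F))
      = -((S.A + S.B₂ * F₀ + S.B₁ * S.B₁ᵀ * X)ᵀ * X) := by
    rw [← Matrix.neg_mul] at hint
    rw [hW.isUnit.mul_right_cancel hint, Matrix.mul_neg, ← mul_assoc, hXU, one_mul]
  have hest := isPseudoStrictBoundedReal_estimator (AL := S.A + L * S.C₂) (M := M) (C₁ := S.C₁)
    (CF := S.C₁ + S.D₁₂ * F) (C₂ := S.C₂) (BL := S.B₁ + L * S.D₂₁) (D := S.D₂₁) (L := L)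
    hYs hYpos hW ?_ horth hric ?_ ?_
  -- This involution sends (x, x_c) to (x + x_c, -x_c).
  · refine LTISystem.IsPseudoStrictBoundedReal.of_involution (T := fromBlocks 1 1 0 (-1)) ?_ ?_
    · rw [fromBlocks_multiply, ← fromBlocks_one]
      simp
    · convert hest using 2
      · simp only [closedLoop, compensator, hCc, ← hL]
        rw [fromBlocks_multiply, fromBlocks_multiply, hM]
        congr 1
        · simp
        · simp [Matrix.mul_add, Matrix.mul_assoc]
          abel
        · simp
        · simp [Matrix.mul_add, Matrix.mul_assoc]
          abel
      · simp only [closedLoop, compensator, ← hL]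
        rw [fromBlocks_mul_fromRows]
        simp
      · simp only [closedLoop, compensator, hCc]
        rw [fromCols_mul_fromBlocks]
        simp
  · rw [← hYc]
    simp only [Matrix.mul_assoc]
  · have := congrArg transpose hYcl
    simp only [transpose_add, transpose_sub, transpose_mul, transpose_transpose, hYs, hE₂s] at this
    simp only [Matrix.mul_assoc] at this hYst ⊢
    rwa [this]
  · rw [hXcl] at hN
    exact IsHurwitz.re_pos_of_intertwine hXst hXpos.isUnit hN

end Plant

end PseudoHinf

end

theorem mainTheorem7 (n m q p : ℕ) (S : PseudoHinf.Plant n m q p)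
    (hE₁ : S.E₁.PosDef) (hE₂ : S.E₂.PosDef)
    (X Y : Matrix (Fin n) (Fin n) ℝ)
    (hX : S.IsStabilizingX X) (hXpos : X.PosDef)
    (hY : S.IsStabilizingY Y) (hYpos : PseudoHinf.IsPseudoPosDef Y)
    (hXY : spectralRadius ℂ (PseudoHinf.toC (X * Y)) < 1) :
    (∃ (k : ℕ) (K : PseudoHinf.Compensator k q p),
        (S.closedLoop K).IsPseudoStrictBoundedReal) ∧
      IsUnit (1 - Y * X) ∧
      (S.closedLoop (S.compensator X Y)).IsPseudoStrictBoundedReal := by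
  obtain ⟨hunit, hcl⟩ := S.isPseudoStrictBoundedReal_closedLoop_compensator hE₁ hE₂ hX hXpos hY
    hYpos hXY
  exact ⟨⟨n, S.compensator X Y, hcl⟩, hunit, hcl⟩
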